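/- Let $(W,S)$ be a finite Coxeter system with length function $\ell$. The (right) weak order on $W$ is the lattice order given by $u\le v$ if and only if $\ell(u)+\ell(u^{-1}v)=\ell(v)$. For $I\subseteq S$, let $W_I=\langle I\rangle$, let $w_{\circ,I}$ be the longest element of $W_I$, and let $W^I=\{w\in W:\ell(ws)>\ell(w)\text{ for all }s\in I\}$. Let $\mathcal P_W=\{xW_I : I\subseteq S,\ x\in W\}$ be the set of standard parabolic cosets; every element of $\mathcal P_W$ can be written uniquely as $xW_I$ with $I\subseteq S$ and $x\in W^I$. The facial weak order on $\mathcal P_W$ is the reflexive and transitive closure of the relations, for $I\subseteq S$ and $x\in W^I$, $$xW_I\lessdot xW_{I\cup\{s\}}\ \text{ if } s\notin I \text{ and } x\in W^{I\cup\{s\}},\qquad xW_I\lessdot x\,w_{\circ,I}\,w_{\circ,I\setminus\{s\}}W_{I\setminus\{s\}}\ \text{ if } s\in I.$$ Let $\equiv$ be any lattice congruence of the weak order. Then every class of $\equiv$ has a greatest and a least element in the weak order; write $\pi^\uparrow(x)$ and $\pi_\downarrow(x)$ for the greatest and the least element of the class of $x$. For all $I\subseteq S$ and $x\in W^I$, there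 is a unique subset $\Sigma^\uparrow(x,I)$ of $S$ that contains no right descent of $\pi^\uparrow(x)$ and satisfies $$xw_{\circ,I}\le\pi^\uparrow(x)\,w_{\circ,\Sigma^\uparrow(x,I)}\quad\text{and}\quad xw_{\circ,I}\equiv\pi^\uparrow(x)\,w_{\circ,\Sigma^\uparrow(x,I)},$$ and a unique set $\Sigma_\downarrow(x,I)$ of right descents of $\pi_\downarrow(xw_{\circ,I})$ that satisfies $$\pi_\downarrow(xw_{\circ,I})\,w_{\circ,\Sigma_\downarrow(x,I)}\le x\quad\text{and}\quad\pi_\downarrow(xw_{\circ,I})\,w_{\circ,\Sigma_\downarrow(x,I)}\equiv x.$$ The maps $\Pi^\uparrow,\Pi_\downarrow:\mathcal P_W\to\mathcal P_W$ defined, for $I\subseteq S$ and $x\in W^I$, by $$\Pi^\uparrow(xW_I)=\pi^\uparrow(x)W_{\Sigma^\uparrow(x,I)},\qquad \Pi_\downarrow(xW_I)=\pi_\downarrow(xw_{\circ,I})W_{\Sigma_\downarrow(x,I)}$$ have the following properties with respect to the facial weak order: (i) $\Pi_\downarrow(F)\le F\le\Pi^\uparrow(F)$ for every $F\in\mathcal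 P_W$; (ii) $\Pi^\uparrow\circ\Pi^\uparrow=\Pi^\uparrow\circ\Pi_\downarrow=\Pi^\uparrow$ and $\Pi_\downarrow\circ\Pi_\downarrow=\Pi_\downarrow\circ\Pi^\uparrow=\Pi_\downarrow$; (iii) $\Pi^\uparrow$ and $\Pi_\downarrow$ are order preserving. Therefore $\Pi^\uparrow(F)=\Pi^\uparrow(G)\iff\Pi_\downarrow(F)=\Pi_\downarrow(G)$ for all $F,G\in\mathcal P_W$, the facial weak order is a lattice order, and the relation on $\mathcal P_W$ given by $\Pi^\uparrow(F)=\Pi^\uparrow(G)$ is a lattice congruence of it. This congruence extends $\equiv$: for all $x,y\in W$, $x\equiv y$ if and only if $\Pi^\uparrow(xW_\varnothing)=\Pi^\uparrow(yW_\varnothing)$. -/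

import Mathlib

/-! Order-theoretic notions, for an order given as a relation. -/

/-- `m` is the meet (greatest lower bound) of `x` and `y` for the order relation `le`. -/
def IsMeetOf {P : Type*} (le : P → P → Prop) (x y m : P) : Prop :=
  le m x ∧ le m y ∧ ∀ z, le z x → le z y → le z m

/-- `j` is the join (least upper bound) of `x` and `y` for the order relation `le`. -/
def IsJoinOf {P : Type*} (le : P → P → Prop) (x y j : P) : Prop :=
  le x j ∧ le y j ∧ ∀ z, le x z → le y z → le j z

/-- The relation `le` is a lattice order: a partial order with all binary meets and joins. -/
structure IsLatticeOrder {P : Type*} (le : P → P → Prop) : Prop where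
  refl : ∀ x, le x x
  trans : ∀ x y z, le x y → le y z → le x z
  antisymm : ∀ x y, le x y → le y x → x = y
  exists_meet : ∀ x y, ∃ m, IsMeetOf le x y m
  exists_join : ∀ x y, ∃ j, IsJoinOf le x y j

/-- For a lattice order `le`, the relation `r` is a lattice congruence: an equivalence relation
that respects meets and joins. (That `le` is a lattice order is not part of this definition.) -/
structure IsLatticeCongruence {P : Type*} (le r : P → P → Prop) : Prop where
  equivalence : Equivalence r
  meet : ∀ x x' y y' m m', r x x' → r y y' →
    IsMeetOf le x y m → IsMeetOf le x' y' m' → r m m'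
  join : ∀ x x' y y' j j', r x x' → r y y' →
    IsJoinOf le x y j → IsJoinOf le x' y' j' → r j j'

namespace CoxeterSystem

section

variable {B W : Type*} [Group W] {M : CoxeterMatrix B} (cs : CoxeterSystem M W)

/-- The (right) weak order: `u ≤ v` when `ℓ(u) + ℓ(u⁻¹ v) = ℓ(v)`. -/
def weakLE (u v : W) : Prop := cs.length u + cs.length (u⁻¹ * v) = cs.length v

/-- The standard parabolic subgroup `W_I`. The set `S` of simple reflections is indexed by `B`,
so that subsets of `S` are given as sets of indices. -/
def parabolic (I : Set B) : Subgroup W := Subgroup.closure (cs.simple '' I)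

/-- The set `W^I` of elements without right descent in `I`. -/
def minReps (I : Set B) : Set W := {w | ∀ s ∈ I, cs.length w < cs.length (w * cs.simple s)}

theorem exists_longest [Finite W] (I : Set B) :
    ∃ w, w ∈ cs.parabolic I ∧ ∀ v ∈ cs.parabolic I, cs.length v ≤ cs.length w := by
  obtain ⟨w, hw, h⟩ := Set.exists_max_image (cs.parabolic I : Set W) cs.length
    (Set.toFinite _) ⟨1, one_mem _⟩
  exact ⟨w, hw, h⟩

/-- The longest element `w_{∘,I}` of `W_I` (the element of `W_I` of maximal length). -/
noncomputable def longest [Finite W] (I : Set B) : W := (cs.exists_longest I).choose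

/-- The coset `x W_I`, as a subset of `W`. -/
def cosetSet (x : W) (I : Set B) : Set W := {w | x⁻¹ * w ∈ cs.parabolic I}

/-- The Coxeter complex: the set of all standard parabolic cosets `x W_I`, `I ⊆ S`, `x ∈ W`. -/
def Face : Type _ := {F : Set W // ∃ (x : W) (I : Set B), F = cs.cosetSet x I}

/-- The coset `x W_I`, as an element of the Coxeter complex. -/
def coset (x : W) (I : Set B) : cs.Face := ⟨cs.cosetSet x I, x, I, rfl⟩

/-- Every standard parabolic coset can be written `x W_I` with `x ∈ W^I`. -/
theorem Face.exists_rep {cs : CoxeterSystem M W} (F : cs.Face) :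
    ∃ p : W × Set B, p.1 ∈ cs.minReps p.2 ∧ F = cs.coset p.1 p.2 := by
  obtain ⟨F, x, I, rfl⟩ := F
  have hne : (cs.cosetSet x I).Nonempty := ⟨x, by simp [cosetSet]⟩
  let y := Function.argminOn cs.length (cs.cosetSet x I) hne
  have hy : x⁻¹ * y ∈ cs.parabolic I := Function.argminOn_mem cs.length (cs.cosetSet x I) hne
  refine ⟨(y, I), ?_, ?_⟩
  · intro s hs
    have hs' : cs.simple s ∈ cs.parabolic I := Subgroup.subset_closure ⟨s, hs, rfl⟩
    have hm : y * cs.simple s ∈ cs.cosetSet x I := by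
      change x⁻¹ * (y * cs.simple s) ∈ cs.parabolic I
      rw [← mul_assoc]
      exact mul_mem hy hs'
    exact lt_of_le_of_ne (Function.argminOn_le cs.length (cs.cosetSet x I) hm)
      (cs.length_mul_simple_ne y s).symm
  · apply Subtype.ext
    ext w
    change x⁻¹ * w ∈ cs.parabolic I ↔ y⁻¹ * w ∈ cs.parabolic I
    have h : x⁻¹ * w = (x⁻¹ * y) * (y⁻¹ * w) := by group
    rw [h]
    exact Subgroup.mul_mem_cancel_left _ hy

/-- The element `x ∈ W^I` with `F = x W_I`. -/
noncomputable def Face.minRep {cs : CoxeterSystem M W} (F : cs.Face) : W :=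
  F.exists_rep.choose.1

/-- The subset `I` of `S` with `F = x W_I`. -/
noncomputable def Face.type {cs : CoxeterSystem M W} (F : cs.Face) : Set B :=
  F.exists_rep.choose.2

/-- The two kinds of cover relations of the facial weak order. -/
inductive FacialCover [Finite W] : cs.Face → cs.Face → Prop
  | up (x : W) (I : Set B) (s : B) (hs : s ∉ I) (hx : x ∈ cs.minReps (I ∪ {s})) :
      FacialCover (cs.coset x I) (cs.coset x (I ∪ {s}))
  | down (x : W) (I : Set B) (s : B) (hs : s ∈ I) (hx : x ∈ cs.minReps I) :
      FacialCover (cs.coset x I)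
        (cs.coset (x * cs.longest I * cs.longest (I \ {s})) (I \ {s}))

/-- The facial weak order: the reflexive transitive closure of the cover relations. -/
def facialLE [Finite W] : cs.Face → cs.Face → Prop := Relation.ReflTransGen cs.FacialCover

/-! In the following, `r` is a lattice congruence of the weak order. -/

variable (r : W → W → Prop)

/-- `m` is the greatest element, in weak order, of the `r`-class of `x`. -/
def IsClassMax (x m : W) : Prop := r x m ∧ ∀ y, r x y → cs.weakLE y m

/-- `m` is the least element, in weak order, of the `r`-class of `x`. -/
def IsClassMin (x m : W) : Prop := r x m ∧ ∀ y, r x y → cs.weakLE m y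

/-- The up projection `π↑`: the greatest element of the `r`-class of `x`. -/
noncomputable def projUp (x : W) : W :=
  @Classical.epsilon W ⟨1⟩ (cs.IsClassMax r x)

/-- The down projection `π↓`: the least element of the `r`-class of `x`. -/
noncomputable def projDown (x : W) : W :=
  @Classical.epsilon W ⟨1⟩ (cs.IsClassMin r x)

/-- `u ≤ v` in weak order and `u ≡ v`. -/
def leEquiv (u v : W) : Prop := cs.weakLE u v ∧ r u v

/-- The property that characterizes the subset `J = Σ↑(x, I)` of `S`: no element of `J` is a right
descent of `π↑(x)`, and `x w_{∘,I}` is both below and congruent to `π↑(x) w_{∘,J}`. -/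
def IsSigmaUp [Finite W] (x : W) (I J : Set B) : Prop :=
  (∀ s ∈ J, ¬ cs.IsRightDescent (cs.projUp r x) s) ∧
    cs.leEquiv r (x * cs.longest I) (cs.projUp r x * cs.longest J)

/-- The property that characterizes the subset `J = Σ↓(x, I)` of `S`: all elements of `J` are right
descents of `π↓(x w_{∘,I})`, and `π↓(x w_{∘,I}) w_{∘,J}` is both below and congruent to `x`. -/
def IsSigmaDown [Finite W] (x : W) (I J : Set B) : Prop :=
  (∀ s ∈ J, cs.IsRightDescent (cs.projDown r (x * cs.longest I)) s) ∧
    cs.leEquiv r (cs.projDown r (x * cs.longest I) * cs.longest J) x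

/-- The subset `Σ↑(x, I)` of `S`. -/
noncomputable def sigmaUp [Finite W] (x : W) (I : Set B) : Set B :=
  Classical.epsilon (cs.IsSigmaUp r x I)

/-- The subset `Σ↓(x, I)` of `S`. -/
noncomputable def sigmaDown [Finite W] (x : W) (I : Set B) : Set B :=
  Classical.epsilon (cs.IsSigmaDown r x I)

/-- The map `Π↑ : x W_I ↦ π↑(x) W_{Σ↑(x, I)}`, where `x ∈ W^I`. -/
noncomputable def facialUp [Finite W] (F : cs.Face) : cs.Face :=
  cs.coset (cs.projUp r F.minRep) (cs.sigmaUp r F.minRep F.type)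

/-- The map `Π↓ : x W_I ↦ π↓(x w_{∘,I}) W_{Σ↓(x, I)}`, where `x ∈ W^I`. -/
noncomputable def facialDown [Finite W] (F : cs.Face) : cs.Face :=
  cs.coset (cs.projDown r (F.minRep * cs.longest F.type)) (cs.sigmaDown r F.minRep F.type)

end

end CoxeterSystem

/-! The proof replaces the facial weak order by a comparison of endpoints. A face F = xW_I is
determined by its shortest element x and its longest element x w_I, and F ≤ G holds exactly when
both endpoints of F lie weakly below those of G (`facialLE_iff`). In these terms Π↑ sends (min, max)
to (π↑(min), π↑(min) ∨ max). This join is again of the form π↑(min) w_J, because for an uncontracted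
cover x ⋖ xs the join π↑(x) ∨ xs covers π↑(x) (`exists_isSigmaUp`). So Π↑ is visibly increasing and
monotone.

Two faces have the same image under Π↑ if and only if their shortest elements are congruent and
their longest elements are congruent (`facialUp_eq_iff`). Left multiplication by w₀ reverses the
weak order, swaps the two endpoints and turns Π↓ into the Π↑ of the dual congruence
(`facialDown_eq_compl`), so Π↓ has the same fibers. A monotone closure operator and a monotone
interior operator with common fibers define a lattice congruence
(`isLatticeCongruence_of_projections`).

The weak order is handled as inclusion of inversion sets (`weakLE_iff_invSet_subset`), which rests
on strong exchange. Both orders are shown to be lattices by constructing joins of two covers of one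
element (`exists_isJoinOf_of_cover`). For faces the main geometric input is
`exists_eq_longest_mul_longest`, on projecting a face to a parabolic subgroup. -/

namespace CoxeterSystem

/-! ### The geometric representation, used to separate the simple reflections. -/

open Polynomial.Chebyshev in
/-- Two reflections whose product of off-diagonal pairings is `4 cos² (π / m)` satisfy the
dihedral relation of order `m`. -/
theorem reflection_mul_reflection_pow_eq_one {V : Type*} [AddCommGroup V] [Module ℝ V]
    {x y : V} {f g : Module.Dual ℝ V} (hf : f x = 2) (hg : g y = 2) {m : ℕ} (hm : 3 ≤ m)
    (h : f y * g x = 4 * Real.cos (Real.pi / m) ^ 2) :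
    (Module.reflection hf * Module.reflection hg) ^ m = 1 := by
  set θ : ℝ := 2 * (Real.pi / m) with hθ
  have hm0 : (0 : ℝ) < m := by positivity
  have ht : 2 * Real.cos θ = f y * g x - 2 := by
    rw [h, hθ, Real.cos_two_mul]; ring
  have hsin : Real.sin θ ≠ 0 := by
    refine (Real.sin_pos_of_pos_of_lt_pi (by positivity) ?_).ne'
    have h3 : (3 : ℝ) ≤ m := by exact_mod_cast hm
    rw [hθ, ← mul_div_assoc, div_lt_iff₀ hm0]
    nlinarith [Real.pi_pos]
  have hmθ : (m : ℝ) * θ = 2 * Real.pi := by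
    rw [hθ]; field_simp
  ext z
  rw [Module.reflection_mul_reflection_pow_apply hf hg m z (2 * Real.cos θ) ht]
  -- The powers are expressed by S_n(2 cos θ) = sin((n+1)θ) / sin θ with mθ = 2π. For m = 2k,
  -- S_{k-1} vanishes since kθ = π; for m = 2k + 1, S_k + S_{k-1} vanishes since (k+1)θ = 2π - kθ.
  rcases Nat.even_or_odd' m with ⟨k, rfl | rfl⟩
  · have e1 : (((2 * k : ℕ) : ℤ) - 2) / 2 = (k : ℤ) - 1 := by omega
    have e2 : (((2 * k : ℕ) : ℤ) - 1) / 2 = (k : ℤ) - 1 := by omega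
    have hS : (S ℝ ((k : ℤ) - 1)).eval (2 * Real.cos θ) = 0 := by
      have := S_two_mul_real_cos θ ((k : ℤ) - 1)
      have hk : ((((k : ℤ) - 1 : ℤ) : ℝ) + 1) * θ = Real.pi := by
        push_cast at hmθ ⊢; linarith
      rw [hk, Real.sin_pi] at this
      exact (mul_eq_zero.mp this).resolve_right hsin
    rw [e1, e2, hS]
    simp
  · have e1 : (((2 * k + 1 : ℕ) : ℤ) - 2) / 2 = (k : ℤ) - 1 := by omega
    have e2 : (((2 * k + 1 : ℕ) : ℤ) - 1) / 2 = (k : ℤ) := by omega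
    have e3 : (((2 * k + 1 : ℕ) : ℤ) - 3) / 2 = (k : ℤ) - 1 := by omega
    have e4 : (((2 * k + 1 : ℕ) : ℤ)) / 2 = (k : ℤ) := by omega
    have hS : (S ℝ (k : ℤ)).eval (2 * Real.cos θ) +
        (S ℝ ((k : ℤ) - 1)).eval (2 * Real.cos θ) = 0 := by
      have h1 := S_two_mul_real_cos θ ((k : ℤ) - 1)
      have h2 := S_two_mul_real_cos θ (k : ℤ)
      have h3 : (((k : ℤ) : ℝ) + 1) * θ = 2 * Real.pi - (((((k : ℤ) - 1 : ℤ) : ℝ)) + 1) * θ := by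
        push_cast at hmθ ⊢; linarith
      rw [h3, Real.sin_two_pi_sub] at h2
      have : ((S ℝ (k : ℤ)).eval (2 * Real.cos θ) +
        (S ℝ ((k : ℤ) - 1)).eval (2 * Real.cos θ)) * Real.sin θ = 0 := by
        rw [add_mul, h1, h2]; ring
      exact (mul_eq_zero.mp this).resolve_right hsin
    rw [e1, e2, e3, e4, hS]
    simp

section

variable {B : Type*} (M : CoxeterMatrix B)

/-- The coroot `2 (e_i, ·)` of the geometric representation on `B →₀ ℝ`. -/
noncomputable def simpleCoroot (i : B) : Module.Dual ℝ (B →₀ ℝ) :=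
  Finsupp.linearCombination ℝ (fun j => -2 * Real.cos (Real.pi / M i j))

theorem simpleCoroot_single (i j : B) :
    simpleCoroot M i (Finsupp.single j 1) = -2 * Real.cos (Real.pi / M i j) := by
  simp [simpleCoroot, Finsupp.linearCombination_single]

theorem simpleCoroot_self (i : B) : simpleCoroot M i (Finsupp.single i 1) = 2 := by
  rw [simpleCoroot_single]; simp

/-- The generators of the geometric representation. -/
noncomputable def simpleReflection (i : B) : (B →₀ ℝ) ≃ₗ[ℝ] (B →₀ ℝ) :=
  Module.reflection (simpleCoroot_self M i)

theorem isLiftable_simpleReflection : M.IsLiftable (simpleReflection M) := by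
  intro i j
  unfold simpleReflection
  have hc : simpleCoroot M i (Finsupp.single j 1) * simpleCoroot M j (Finsupp.single i 1) =
      4 * Real.cos (Real.pi / M i j) ^ 2 := by
    rw [simpleCoroot_single, simpleCoroot_single, M.symmetric j i]; ring
  by_cases hij : i = j
  · subst hij
    rw [M.diagonal, pow_one]
    refine LinearEquiv.ext fun z => ?_
    rw [LinearEquiv.mul_apply]
    exact Module.involutive_reflection (simpleCoroot_self M i) z
  have h1 : M i j ≠ 1 := M.off_diagonal i j hij
  rcases Nat.lt_or_ge (M i j) 3 with h | h
  · have h02 : M i j = 0 ∨ M i j = 2 := by omega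
    rcases h02 with h0 | h2
    · rw [h0, pow_zero]
    · have a1 := simpleCoroot_single M i j
      have a2 := simpleCoroot_single M j i
      rw [M.symmetric j i] at a2
      rw [h2] at a1 a2 ⊢
      simp only [Nat.cast_ofNat, Real.cos_pi_div_two, mul_zero] at a1 a2
      refine LinearEquiv.ext fun z => ?_
      rw [pow_two]
      simp only [LinearEquiv.mul_apply, Module.reflection_apply, map_sub, map_smul, a1, a2,
        simpleCoroot_self, LinearEquiv.coe_one, id]
      module
  · exact reflection_mul_reflection_pow_eq_one _ _ h hc

end

section

variable {B W : Type*} [Group W] {M : CoxeterMatrix B} (cs : CoxeterSystem M W)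

/-- In the geometric representation the i-th coordinate of e_i becomes -1 under s_i and stays 1
under s_j for j ≠ i. -/
theorem simple_injective : Function.Injective cs.simple := by
  intro i j hij
  by_contra hne
  have h := congrArg (cs.lift ⟨_, isLiftable_simpleReflection M⟩) hij
  rw [cs.lift_apply_simple, cs.lift_apply_simple] at h
  have h' := DFunLike.congr_fun (DFunLike.congr_fun h (Finsupp.single i 1)) i
  simp only [simpleReflection] at h'
  rw [Module.reflection_apply_self, Module.reflection_apply] at h'
  have hz : (Finsupp.single j (1 : ℝ)) i = 0 := Finsupp.single_eq_of_ne hne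
  simp only [Finsupp.neg_apply, Finsupp.sub_apply, Finsupp.smul_apply, Finsupp.single_eq_same,
    hz, smul_eq_mul, mul_zero, sub_zero] at h'
  linarith

/-! ### The reflection cocycle -/

open Classical in
/-- The action of a simple reflection on signed reflections. -/
noncomputable def signedConj (i : B) : Function.End (W × ZMod 2) :=
  fun p => (cs.simple i * p.1 * cs.simple i, p.2 + if p.1 = cs.simple i then 1 else 0)

-- Prefixing a letter s to a word conjugates its inversion sequence by s and adjoins s itself, which
-- is exactly the sign flip in `signedConj`.
open Classical in
theorem prod_map_signedConj (ω : List B) (p : W × ZMod 2) :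
    (ω.map cs.signedConj).prod p =
      (cs.wordProd ω * p.1 * (cs.wordProd ω)⁻¹,
        p.2 + ((cs.leftInvSeq ω).count (cs.wordProd ω * p.1 * (cs.wordProd ω)⁻¹) : ZMod 2)) := by
  induction ω with
  | nil => simp [Function.End.one_def]
  | cons i ω ih =>
    rw [List.map_cons, List.prod_cons]
    change cs.signedConj i ((ω.map cs.signedConj).prod p) = _
    rw [ih]
    set q := cs.wordProd ω * p.1 * (cs.wordProd ω)⁻¹ with hq
    have hc : cs.wordProd (i :: ω) * p.1 * (cs.wordProd (i :: ω))⁻¹ =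
        MulAut.conj (cs.simple i) q := by
      rw [hq, cs.wordProd_cons, MulAut.conj_apply]; group
    rw [hc, leftInvSeq, List.count_cons, List.count_map_of_injective _ _ (MulEquiv.injective _)]
    have hs : (cs.simple i == MulAut.conj (cs.simple i) q) = true ↔ q = cs.simple i := by
      rw [beq_iff_eq, MulAut.conj_apply, cs.inv_simple]
      constructor
      · intro h
        have := congrArg (fun w => cs.simple i * w * cs.simple i) h
        simpa [mul_assoc] using this.symm
      · rintro h; rw [h]; simp
    rw [if_congr hs rfl rfl]
    simp only [signedConj, MulAut.conj_apply, cs.inv_simple]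
    push_cast
    rw [add_assoc]

theorem prod_map_alternatingWord {G : Type*} [Monoid G] (f : B → G) (i j : B) (m : ℕ) :
    ((alternatingWord i j (2 * m)).map f).prod = (f i * f j) ^ m := by
  induction m with
  | zero => simp [alternatingWord]
  | succ m ih =>
    rw [show 2 * (m + 1) = 2 * m + 1 + 1 by ring, alternatingWord_succ', alternatingWord_succ']
    rw [if_neg (by simp), if_pos (by simp), List.map_cons, List.map_cons, List.prod_cons,
      List.prod_cons, ih, pow_succ', mul_assoc]

-- The n-th entry is an alternating word of length 2n + 1, so by the braid relation the sequence has
-- period `M i j`; its two halves coincide. This makes `signedConj` respect the braid relations.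
open Classical in
theorem even_count_leftInvSeq_alternatingWord (i j : B) (t : W) :
    Even ((cs.leftInvSeq (alternatingWord i j (2 * M i j))).count t) := by
  set L := cs.leftInvSeq (alternatingWord i j (2 * M i j)) with hL
  have hlen : L.length = 2 * M i j := by simp [hL]
  have h : L.take (M i j) = L.drop (M i j) := by
    apply List.ext_getElem
    · simp [hlen]; omega
    · intro k h1 h2
      have hk : k < M i j := by simp at h1; omega
      rw [List.getElem_take, List.getElem_drop]
      have key : ∀ (n : ℕ) (hn : n < L.length),
          L[n] = cs.wordProd (alternatingWord j i (2 * n + 1)) :=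
        fun n hn => cs.getElem_leftInvSeq_alternatingWord i j (M i j) n (by omega)
      rw [key, key,
        cs.prod_alternatingWord_eq_mul_pow, cs.prod_alternatingWord_eq_mul_pow,
        if_neg (by simp), if_neg (by simp),
        show (2 * k + 1) / 2 = k by omega, show (2 * (M i j + k) + 1) / 2 = M i j + k by omega,
        pow_add, cs.simple_mul_simple_pow', one_mul]
  rw [← List.take_append_drop (M i j) L, List.count_append, h]
  exact ⟨_, rfl⟩

theorem isLiftable_signedConj : M.IsLiftable cs.signedConj := by
  classical
  intro i j
  rw [← prod_map_alternatingWord]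
  funext p
  rw [cs.prod_map_signedConj]
  have h1 : cs.wordProd (alternatingWord i j (2 * M i j)) = 1 := by
    rw [cs.prod_alternatingWord_eq_mul_pow, if_pos (by simp)]
    simp
  rw [h1, (ZMod.natCast_eq_zero_iff_even).mpr (cs.even_count_leftInvSeq_alternatingWord i j _)]
  simp [Function.End.one_def]

/-- The action of `W` on signed reflections. -/
noncomputable def signedConjHom : W →* Function.End (W × ZMod 2) :=
  cs.lift ⟨_, cs.isLiftable_signedConj⟩

open Classical in
theorem signedConjHom_wordProd (ω : List B) (p : W × ZMod 2) :
    cs.signedConjHom (cs.wordProd ω) p =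
      (cs.wordProd ω * p.1 * (cs.wordProd ω)⁻¹,
        p.2 + ((cs.leftInvSeq ω).count (cs.wordProd ω * p.1 * (cs.wordProd ω)⁻¹) : ZMod 2)) := by
  rw [← cs.prod_map_signedConj, wordProd, map_list_prod, List.map_map]
  rw [show ⇑cs.signedConjHom ∘ cs.simple = cs.signedConj from
    funext fun i => cs.lift_apply_simple _ i]

/-- The parity with which `t` occurs in the left inversion sequence of any word for `w`. -/
noncomputable def invParity (w t : W) : ZMod 2 := (cs.signedConjHom w (w⁻¹ * t * w, 0)).2

open Classical in
theorem invParity_wordProd (ω : List B) (t : W) :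
    cs.invParity (cs.wordProd ω) t = ((cs.leftInvSeq ω).count t : ZMod 2) := by
  rw [invParity, signedConjHom_wordProd]
  simp [mul_assoc]

theorem signedConjHom_apply (w : W) (p : W × ZMod 2) :
    cs.signedConjHom w p = (w * p.1 * w⁻¹, p.2 + cs.invParity w (w * p.1 * w⁻¹)) := by
  obtain ⟨ω, rfl⟩ := cs.wordProd_surjective w
  classical
  rw [signedConjHom_wordProd, invParity_wordProd]

theorem invParity_mul (u v t : W) :
    cs.invParity (u * v) t = cs.invParity u t + cs.invParity v (u⁻¹ * t * u) := by
  rw [invParity, map_mul]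
  change (cs.signedConjHom u (cs.signedConjHom v _)).2 = _
  rw [signedConjHom_apply, signedConjHom_apply]
  simp [mul_assoc, add_comm]

theorem invParity_one (t : W) : cs.invParity 1 t = 0 := by
  simp [invParity, Function.End.one_def]

theorem invParity_simple_self (i : B) : cs.invParity (cs.simple i) (cs.simple i) = 1 := by
  classical
  rw [← cs.wordProd_singleton, invParity_wordProd]
  simp

/-- For t = u s u⁻¹ the cocycle identity leaves the parity of s at itself, since the contributions
of u and u⁻¹ cancel by the same identity for u u⁻¹ = 1. -/
theorem invParity_reflection_self {t : W} (ht : cs.IsReflection t) : cs.invParity t t = 1 := by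
  obtain ⟨u, i, rfl⟩ := ht
  have h := cs.invParity_mul u u⁻¹ (u * cs.simple i * u⁻¹)
  rw [mul_inv_cancel, invParity_one] at h
  rw [invParity_mul, invParity_mul]
  have e1 : u⁻¹ * (u * cs.simple i * u⁻¹) * u = cs.simple i := by group
  have e2 : (u * cs.simple i)⁻¹ * (u * cs.simple i * u⁻¹) * (u * cs.simple i) = cs.simple i := by
    group
  rw [e1] at h
  rw [e1, e2, invParity_simple_self, add_right_comm, ← h, zero_add]

theorem isLeftInversion_of_invParity {w t : W} (h : cs.invParity w t = 1) :
    cs.IsLeftInversion w t := by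
  classical
  obtain ⟨ω, hω, rfl⟩ := cs.exists_isReduced w
  rw [invParity_wordProd] at h
  refine cs.isLeftInversion_of_mem_leftInvSeq hω (List.count_pos_iff.mp ?_)
  rcases Nat.eq_zero_or_pos ((cs.leftInvSeq ω).count t) with h0 | h0
  · rw [h0] at h; simp at h
  · exact h0

/-- Strong exchange: `t` is a left inversion of `w` if and only if its parity is odd. -/
theorem isLeftInversion_iff_invParity {w t : W} (ht : cs.IsReflection t) :
    cs.IsLeftInversion w t ↔ cs.invParity w t = 1 := by
  refine ⟨fun h => ?_, cs.isLeftInversion_of_invParity⟩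
  by_contra hne
  have h2 : ∀ a : ZMod 2, a ≠ 1 → 1 + a = 1 := by decide
  -- If t were even for w, it would be odd for t w, so t would shorten t w as well as w.
  have h3 : cs.invParity (t * w) t = 1 := by
    rw [invParity_mul, cs.invParity_reflection_self ht,
      show t⁻¹ * t * t = t by group]
    exact h2 _ hne
  have h4 := (cs.isLeftInversion_of_invParity h3).2
  rw [← mul_assoc, ht.mul_self, one_mul] at h4
  exact absurd h.2 (by omega)

theorem isLeftInversion_iff_mem_leftInvSeq {ω : List B} (hω : cs.IsReduced ω) {t : W} :
    cs.IsLeftInversion (cs.wordProd ω) t ↔ t ∈ cs.leftInvSeq ω := by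
  classical
  refine ⟨fun h => ?_, cs.isLeftInversion_of_mem_leftInvSeq hω⟩
  rw [cs.isLeftInversion_iff_invParity h.1, invParity_wordProd] at h
  by_contra hn
  rw [List.count_eq_zero_of_not_mem hn] at h
  simp at h

/-! ### Inversion sets -/

/-- The set of left inversions. -/
def invSet (w : W) : Set W := {t | cs.IsLeftInversion w t}

theorem mem_invSet {w t : W} : t ∈ cs.invSet w ↔ cs.IsLeftInversion w t := Iff.rfl

/-- The mod 2 cocycle identity, read as N(uv) = N(u) △ u N(v) u⁻¹. -/
theorem mem_invSet_mul {u v t : W} :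
    t ∈ cs.invSet (u * v) ↔ Xor (t ∈ cs.invSet u) (u⁻¹ * t * u ∈ cs.invSet v) := by
  by_cases ht : cs.IsReflection t
  · have ht' : cs.IsReflection (u⁻¹ * t * u) := by simpa using ht.conj u⁻¹
    simp only [mem_invSet, cs.isLeftInversion_iff_invParity ht,
      cs.isLeftInversion_iff_invParity ht', invParity_mul]
    generalize cs.invParity u t = a
    generalize cs.invParity v (u⁻¹ * t * u) = b
    revert a b
    unfold Xor
    decide
  · have ht' : ¬ cs.IsReflection (u⁻¹ * t * u) := fun h => ht (by
      simpa [mul_assoc] using h.conj u)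
    simp [mem_invSet, IsLeftInversion, ht, ht', Xor]

theorem invSet_finite_and_ncard (w : W) :
    (cs.invSet w).Finite ∧ (cs.invSet w).ncard = cs.length w := by
  classical
  obtain ⟨ω, hω, rfl⟩ := cs.exists_isReduced w
  have h : cs.invSet (cs.wordProd ω) = ((cs.leftInvSeq ω).toFinset : Set W) := by
    ext t; simp [mem_invSet, cs.isLeftInversion_iff_mem_leftInvSeq hω]
  rw [h]
  refine ⟨Finset.finite_toSet _, ?_⟩
  rw [Set.ncard_coe_finset, List.toFinset_card_of_nodup hω.nodup_leftInvSeq, hω.eq]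
  simp

theorem invSet_finite (w : W) : (cs.invSet w).Finite := (cs.invSet_finite_and_ncard w).1

theorem ncard_invSet (w : W) : (cs.invSet w).ncard = cs.length w :=
  (cs.invSet_finite_and_ncard w).2

theorem invSet_one : cs.invSet 1 = ∅ := by
  rw [← Set.ncard_eq_zero (cs.invSet_finite 1), ncard_invSet, length_one]

theorem eq_one_of_invSet_eq_empty {w : W} (h : cs.invSet w = ∅) : w = 1 := by
  rw [← cs.length_eq_zero_iff, ← ncard_invSet, h, Set.ncard_empty]

theorem simple_mem_invSet {w : W} {i : B} : cs.simple i ∈ cs.invSet w ↔ cs.IsLeftDescent w i :=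
  cs.isLeftInversion_simple_iff_isLeftDescent w i

theorem invSet_simple (i : B) : cs.invSet (cs.simple i) = {cs.simple i} := by
  have h := cs.ncard_invSet (cs.simple i)
  rw [length_simple, Set.ncard_eq_one] at h
  obtain ⟨a, ha⟩ := h
  have : cs.simple i ∈ cs.invSet (cs.simple i) := by
    rw [simple_mem_invSet]; simp [IsLeftDescent]
  rw [ha] at this ⊢
  rw [Set.mem_singleton_iff.mp this]

/-- Length is the number of inversions, and a symmetric difference has the sum of the two
cardinalities only when the sets are disjoint. -/
theorem weakLE_iff_disjoint {u w : W} :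
    cs.weakLE u (u * w) ↔ ∀ t ∈ cs.invSet u, u⁻¹ * t * u ∉ cs.invSet w := by
  set c : W → W := fun t => u * t * u⁻¹ with hc
  have hci : Function.Injective c := fun a b h => by simpa [hc] using h
  have hA := cs.invSet_finite u
  have hB : (c '' cs.invSet w).Finite := (cs.invSet_finite w).image c
  have hmem : ∀ t, t ∈ c '' cs.invSet w ↔ u⁻¹ * t * u ∈ cs.invSet w := by
    intro t
    constructor
    · rintro ⟨a, ha, rfl⟩
      simpa [hc, mul_assoc] using ha
    · intro h
      exact ⟨_, h, by simp [hc, mul_assoc]⟩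
  have hAB : cs.invSet (u * w) = symmDiff (cs.invSet u) (c '' cs.invSet w) := by
    ext t
    rw [mem_invSet_mul, Set.mem_symmDiff, hmem, Xor]
  have hcard : (c '' cs.invSet w).ncard = cs.length w := by
    rw [Set.ncard_image_of_injective _ hci, ncard_invSet]
  have hsub : cs.invSet (u * w) = (cs.invSet u ∪ c '' cs.invSet w) \
      (cs.invSet u ∩ c '' cs.invSet w) := by
    rw [hAB]; exact symmDiff_eq_sup_sdiff_inf _ _
  have h1 := Set.ncard_union_add_ncard_inter (cs.invSet u) (c '' cs.invSet w) hA hB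
  have h2 : (cs.invSet (u * w)).ncard + (cs.invSet u ∩ c '' cs.invSet w).ncard =
      (cs.invSet u ∪ c '' cs.invSet w).ncard := by
    rw [hsub]
    exact Set.ncard_sdiff_add_ncard_of_subset
      (Set.inter_subset_left.trans Set.subset_union_left) (hA.union hB)
  rw [ncard_invSet, hcard] at h1
  rw [ncard_invSet] at h2
  have h3 : cs.weakLE u (u * w) ↔ (cs.invSet u ∩ c '' cs.invSet w).ncard = 0 := by
    unfold weakLE
    rw [inv_mul_cancel_left]
    omega
  rw [h3, Set.ncard_eq_zero (hA.inter_of_left _), Set.eq_empty_iff_forall_notMem]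
  constructor
  · intro h t ht ht'
    exact h t ⟨ht, (hmem t).2 ht'⟩
  · rintro h t ⟨ht, ht'⟩
    exact h t ht ((hmem t).1 ht')

theorem weakLE_iff_invSet_subset {u v : W} : cs.weakLE u v ↔ cs.invSet u ⊆ cs.invSet v := by
  obtain ⟨w, rfl⟩ : ∃ w, v = u * w := ⟨u⁻¹ * v, by group⟩
  rw [weakLE_iff_disjoint]
  constructor
  · intro h t ht
    exact cs.mem_invSet_mul.2 (Or.inl ⟨ht, h t ht⟩)
  · intro h t ht ht'
    rcases cs.mem_invSet_mul.1 (h ht) with ⟨_, h2⟩ | ⟨_, h2⟩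
    · exact h2 ht'
    · exact h2 ht

end

end CoxeterSystem

namespace CoxeterSystem

section

variable {B W : Type*} [Group W] {M : CoxeterMatrix B} (cs : CoxeterSystem M W)

/-! ### Elementary properties of the weak order -/

theorem weakLE_refl (u : W) : cs.weakLE u u := by simp [weakLE]

theorem weakLE_trans {u v w : W} (h : cs.weakLE u v) (h' : cs.weakLE v w) : cs.weakLE u w := by
  rw [weakLE_iff_invSet_subset] at *
  exact h.trans h'

theorem eq_of_length_inv_mul_eq_zero {u v : W} (h : cs.length (u⁻¹ * v) = 0) : u = v := by
  rw [cs.length_eq_zero_iff] at h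
  exact inv_mul_eq_one.mp h

theorem weakLE_antisymm {u v : W} (h : cs.weakLE u v) (h' : cs.weakLE v u) : u = v := by
  unfold weakLE at h h'
  exact cs.eq_of_length_inv_mul_eq_zero (by omega)

theorem weakLE_length_le {u v : W} (h : cs.weakLE u v) : cs.length u ≤ cs.length v := by
  unfold weakLE at h; omega

theorem eq_of_weakLE_of_length_le {u v : W} (h : cs.weakLE u v)
    (h' : cs.length v ≤ cs.length u) : u = v := by
  unfold weakLE at h
  exact cs.eq_of_length_inv_mul_eq_zero (by omega)

theorem one_weakLE (u : W) : cs.weakLE 1 u := by simp [weakLE]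

theorem weakLE_mul_iff {u v : W} :
    cs.weakLE u (u * v) ↔ cs.length (u * v) = cs.length u + cs.length v := by
  rw [weakLE, inv_mul_cancel_left, eq_comm]

/-- Lengths add along x · a · (a⁻¹b) as a whole, so subadditivity is an equality at each step. -/
theorem weakLE_mul_mul {x a b : W} (hb : cs.weakLE x (x * b)) (hab : cs.weakLE a b) :
    cs.weakLE x (x * a) ∧ cs.weakLE (x * a) (x * b) := by
  rw [weakLE_mul_iff] at hb
  have h1 := cs.length_mul_le (x * a) (a⁻¹ * b)
  have h2 := cs.length_mul_le x a
  rw [show x * a * (a⁻¹ * b) = x * b by group] at h1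
  unfold weakLE at *
  rw [show x⁻¹ * (x * a) = a by group, show (x * a)⁻¹ * (x * b) = a⁻¹ * b by group]
  omega

theorem weakLE_mul_mul_iff {x a b : W} (ha : cs.weakLE x (x * a)) (hb : cs.weakLE x (x * b)) :
    cs.weakLE (x * a) (x * b) ↔ cs.weakLE a b := by
  refine ⟨fun h => ?_, fun h => (cs.weakLE_mul_mul hb h).2⟩
  rw [weakLE_mul_iff] at ha hb
  unfold weakLE at *
  rw [show (x * a)⁻¹ * (x * b) = a⁻¹ * b by group] at h
  omega

theorem simple_weakLE_iff {i : B} {b : W} : cs.weakLE (cs.simple i) b ↔ cs.IsLeftDescent b i := by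
  rw [weakLE_iff_invSet_subset, invSet_simple, Set.singleton_subset_iff, simple_mem_invSet]

theorem weakLE_mul_simple_iff {x : W} {i : B} :
    cs.weakLE x (x * cs.simple i) ↔ ¬ cs.IsRightDescent x i := by
  rw [weakLE_mul_iff, length_simple, not_isRightDescent_iff]

theorem mul_simple_ne (x : W) (i : B) : x * cs.simple i ≠ x := fun h =>
  cs.length_mul_simple_ne x i (by rw [h])

theorem mem_invSet_inv {x t : W} : t ∈ cs.invSet x⁻¹ ↔ x * t * x⁻¹ ∈ cs.invSet x := by
  have h : ¬ (t ∈ cs.invSet (x⁻¹ * x)) := by rw [inv_mul_cancel, invSet_one]; exact id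
  rw [mem_invSet_mul, inv_inv, Xor] at h
  tauto

theorem exists_mul_simple_weakLE {u v : W} (h : cs.weakLE u v) (hne : u ≠ v) :
    ∃ i, ¬ cs.IsRightDescent u i ∧ cs.weakLE (u * cs.simple i) v := by
  have h1 : u⁻¹ * v ≠ 1 := fun h => hne (inv_mul_eq_one.mp h)
  obtain ⟨i, hi⟩ := cs.exists_leftDescent_of_ne_one h1
  have hv : u * (u⁻¹ * v) = v := by group
  rw [← hv] at h
  obtain ⟨h2, h3⟩ := cs.weakLE_mul_mul h (cs.simple_weakLE_iff.2 hi)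
  rw [hv] at h3
  exact ⟨i, cs.weakLE_mul_simple_iff.1 h2, h3⟩

theorem eq_or_eq_of_weakLE_mul_simple {x z : W} {i : B} (hi : ¬ cs.IsRightDescent x i)
    (h1 : cs.weakLE x z) (h2 : cs.weakLE z (x * cs.simple i)) :
    z = x ∨ z = x * cs.simple i := by
  rw [not_isRightDescent_iff] at hi
  have h3 := cs.weakLE_length_le h1
  have h4 := cs.weakLE_length_le h2
  rcases Nat.lt_or_ge (cs.length x) (cs.length z) with h | h
  · exact Or.inr (cs.eq_of_weakLE_of_length_le h2 (by omega))
  · exact Or.inl (cs.eq_of_weakLE_of_length_le h1 h).symm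

/-! ### Standard parabolic subgroups -/

theorem simple_mem_parabolic {J : Set B} {j : B} (hj : j ∈ J) :
    cs.simple j ∈ cs.parabolic J := Subgroup.subset_closure ⟨j, hj, rfl⟩

theorem parabolic_mono {I J : Set B} (h : I ⊆ J) : cs.parabolic I ≤ cs.parabolic J :=
  Subgroup.closure_mono (Set.image_mono h)

theorem parabolic_univ : cs.parabolic Set.univ = ⊤ := by
  rw [parabolic, Set.image_univ, cs.subgroup_closure_range_simple]

theorem parabolic_empty : cs.parabolic ∅ = ⊥ := by
  rw [parabolic, Set.image_empty, Subgroup.closure_empty]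

/-- Exchange condition: either the word prefixed by j is reduced, or s_j occurs in the inversion
sequence and a letter is deleted. Either way no letter outside J appears. -/
theorem exists_isReduced_simple_mul {J : Set B} {j : B} (hj : j ∈ J) {ω : List B}
    (hω : cs.IsReduced ω) (hJ : ∀ i ∈ ω, i ∈ J) :
    ∃ ω' : List B, (∀ i ∈ ω', i ∈ J) ∧ cs.IsReduced ω' ∧
      cs.simple j * cs.wordProd ω = cs.wordProd ω' := by
  by_cases h : cs.IsLeftDescent (cs.wordProd ω) j
  · have h1 : cs.simple j ∈ cs.leftInvSeq ω := by
      rw [← cs.isLeftInversion_iff_mem_leftInvSeq hω]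
      exact (cs.isLeftInversion_simple_iff_isLeftDescent _ _).2 h
    obtain ⟨k, hk, hk'⟩ := List.mem_iff_getElem.mp h1
    have h2 := cs.getD_leftInvSeq_mul_wordProd ω k
    rw [List.getD_eq_getElem _ _ hk, hk'] at h2
    refine ⟨ω.eraseIdx k, fun i hi => hJ i (List.mem_of_mem_eraseIdx hi), ?_, h2⟩
    rw [cs.length_leftInvSeq] at hk
    rw [isLeftDescent_iff, h2, hω.eq] at h
    have := List.length_eraseIdx_add_one hk
    unfold IsReduced
    omega
  · refine ⟨j :: ω, ?_, ?_, (cs.wordProd_cons j ω).symm⟩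
    · intro i hi
      rcases List.mem_cons.1 hi with rfl | hi
      · exact hj
      · exact hJ i hi
    · rw [not_isLeftDescent_iff, hω.eq] at h
      unfold IsReduced
      rw [wordProd_cons, h, List.length_cons]

theorem exists_isReduced_of_mem_parabolic {J : Set B} {w : W} (hw : w ∈ cs.parabolic J) :
    ∃ ω : List B, (∀ i ∈ ω, i ∈ J) ∧ cs.IsReduced ω ∧ w = cs.wordProd ω := by
  unfold parabolic at hw
  induction hw using Subgroup.closure_induction_left with
  | one => exact ⟨[], by simp, by simp [IsReduced], by simp⟩
  | mul_left x hx y hy ih =>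
    obtain ⟨j, hj, rfl⟩ := hx
    obtain ⟨ω, h1, h2, rfl⟩ := ih
    exact cs.exists_isReduced_simple_mul hj h2 h1
  | inv_mul_cancel x hx y hy ih =>
    obtain ⟨j, hj, rfl⟩ := hx
    obtain ⟨ω, h1, h2, rfl⟩ := ih
    rw [inv_simple]
    exact cs.exists_isReduced_simple_mul hj h2 h1

theorem simple_mem_parabolic_iff {J : Set B} {j : B} :
    cs.simple j ∈ cs.parabolic J ↔ j ∈ J := by
  refine ⟨fun h => ?_, cs.simple_mem_parabolic⟩
  obtain ⟨ω, h1, h2, h3⟩ := cs.exists_isReduced_of_mem_parabolic h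
  have h4 : ω.length = 1 := by rw [← h2.eq, ← h3, length_simple]
  obtain ⟨i, rfl⟩ := List.length_eq_one_iff.mp h4
  rw [wordProd_singleton] at h3
  rw [cs.simple_injective h3]
  exact h1 i (by simp)

theorem parabolic_injective : Function.Injective cs.parabolic := by
  intro I J h
  ext i
  rw [← cs.simple_mem_parabolic_iff, h, cs.simple_mem_parabolic_iff]

theorem exists_leftDescent_of_mem_parabolic {J : Set B} {w : W} (hw : w ∈ cs.parabolic J)
    (hne : w ≠ 1) : ∃ j ∈ J, cs.IsLeftDescent w j := by
  obtain ⟨ω, h1, h2, rfl⟩ := cs.exists_isReduced_of_mem_parabolic hw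
  cases ω with
  | nil => simp at hne
  | cons j ω =>
    refine ⟨j, h1 j (by simp), ?_⟩
    have h3 := cs.length_wordProd_le ω
    unfold IsLeftDescent
    rw [h2.eq, wordProd_cons, simple_mul_simple_cancel_left, List.length_cons]
    omega

theorem invSet_subset_parabolic {J : Set B} {w : W} (hw : w ∈ cs.parabolic J) :
    cs.invSet w ⊆ cs.parabolic J := by
  unfold parabolic at hw
  induction hw using Subgroup.closure_induction_left with
  | one => rw [invSet_one]; exact Set.empty_subset _
  | mul_left x hx y hy ih =>
    obtain ⟨j, hj, rfl⟩ := hx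
    have hm := cs.simple_mem_parabolic hj
    intro t ht
    rcases cs.mem_invSet_mul.1 ht with h | h
    · have := h.1
      rw [invSet_simple] at this
      rw [Set.mem_singleton_iff.mp this]
      exact hm
    · have := mul_mem (mul_mem hm (ih h.1)) (inv_mem hm)
      simpa [mul_assoc] using this
  | inv_mul_cancel x hx y hy ih =>
    obtain ⟨j, hj, rfl⟩ := hx
    rw [inv_simple]
    have hm := cs.simple_mem_parabolic hj
    intro t ht
    rcases cs.mem_invSet_mul.1 ht with h | h
    · have := h.1
      rw [invSet_simple] at this
      rw [Set.mem_singleton_iff.mp this]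
      exact hm
    · have := mul_mem (mul_mem hm (ih h.1)) (inv_mem hm)
      simpa [mul_assoc] using this

/-- `v` is the shortest element of the coset `W_J v`. -/
def IsLeftMin (J : Set B) (v : W) : Prop := ∀ t ∈ cs.parabolic J, t ∉ cs.invSet v

theorem exists_parabolic_mul_isLeftMin (J : Set B) (w : W) :
    ∃ u ∈ cs.parabolic J, ∃ v, cs.IsLeftMin J v ∧ w = u * v := by
  let C : Set W := {v | w * v⁻¹ ∈ cs.parabolic J}
  have hne : C.Nonempty := ⟨w, by simp [C]⟩
  let v := Function.argminOn cs.length C hne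
  have hv : w * v⁻¹ ∈ cs.parabolic J := Function.argminOn_mem cs.length C hne
  refine ⟨w * v⁻¹, hv, v, fun t ht htv => ?_, by group⟩
  have hm : t * v ∈ C := by
    change w * (t * v)⁻¹ ∈ cs.parabolic J
    rw [mul_inv_rev, ← mul_assoc]
    exact mul_mem hv (inv_mem ht)
  exact absurd htv.2 (not_lt.2 (Function.argminOn_le cs.length C hm))

theorem weakLE_mul_of_isLeftMin {J : Set B} {u v : W} (hu : u ∈ cs.parabolic J)
    (hv : cs.IsLeftMin J v) : cs.weakLE u (u * v) := by
  rw [weakLE_iff_disjoint]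
  intro t ht
  exact hv _ (mul_mem (mul_mem (inv_mem hu) (cs.invSet_subset_parabolic hu ht)) hu)

/-- The factor v contributes no reflection of W_J. Thus u is the projection of uv to W_J, and this
projection preserves the weak order. -/
theorem mem_invSet_mul_of_isLeftMin {J : Set B} {u v t : W} (hu : u ∈ cs.parabolic J)
    (hv : cs.IsLeftMin J v) (ht : t ∈ cs.parabolic J) :
    t ∈ cs.invSet (u * v) ↔ t ∈ cs.invSet u := by
  have := hv _ (mul_mem (mul_mem (inv_mem hu) ht) hu)
  rw [mem_invSet_mul, Xor]
  tauto

theorem isLeftMin_iff {J : Set B} {v : W} :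
    cs.IsLeftMin J v ↔ ∀ j ∈ J, ¬ cs.IsLeftDescent v j := by
  constructor
  · intro h j hj hd
    exact h _ (cs.simple_mem_parabolic hj) (cs.simple_mem_invSet.2 hd)
  · intro h
    -- A nontrivial W_J-factor has a left descent in J, which the whole product inherits.
    obtain ⟨u, hu, v', hv', rfl⟩ := cs.exists_parabolic_mul_isLeftMin J v
    by_cases hu1 : u = 1
    · simpa [hu1] using hv'
    · obtain ⟨j, hj, hd⟩ := cs.exists_leftDescent_of_mem_parabolic hu hu1
      exact absurd (cs.simple_mem_invSet.1 ((cs.mem_invSet_mul_of_isLeftMin hu hv'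
        (cs.simple_mem_parabolic hj)).2 (cs.simple_mem_invSet.2 hd))) (h j hj)

theorem mem_minReps_iff {I : Set B} {x : W} :
    x ∈ cs.minReps I ↔ ∀ i ∈ I, ¬ cs.IsRightDescent x i := by
  constructor
  · intro h i hi hd
    exact absurd hd (not_lt.2 (h i hi).le)
  · intro h i hi
    exact lt_of_le_of_ne (not_lt.1 (h i hi)) (cs.length_mul_simple_ne x i).symm

theorem mem_minReps_iff_isLeftMin {I : Set B} {x : W} :
    x ∈ cs.minReps I ↔ cs.IsLeftMin I x⁻¹ := by
  simp only [mem_minReps_iff, isLeftMin_iff, cs.isLeftDescent_inv_iff]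

theorem weakLE_mul_of_mem_minReps {I : Set B} {x u : W} (hx : x ∈ cs.minReps I)
    (hu : u ∈ cs.parabolic I) : cs.weakLE x (x * u) := by
  rw [weakLE_iff_disjoint]
  intro t ht ht'
  refine cs.mem_minReps_iff_isLeftMin.1 hx _ (cs.invSet_subset_parabolic hu ht') ?_
  rw [mem_invSet_inv]
  simpa [mul_assoc] using ht

theorem eq_one_of_isLeftMin_of_mem {J : Set B} {v : W} (hv : cs.IsLeftMin J v)
    (h : v ∈ cs.parabolic J) : v = 1 := by
  by_contra hne
  obtain ⟨j, hj, hd⟩ := cs.exists_leftDescent_of_mem_parabolic h hne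
  exact cs.isLeftMin_iff.1 hv j hj hd

/-! ### Longest elements -/

variable [Finite W]

theorem longest_mem (I : Set B) : cs.longest I ∈ cs.parabolic I :=
  (cs.exists_longest I).choose_spec.1

theorem length_le_longest {I : Set B} {v : W} (hv : v ∈ cs.parabolic I) :
    cs.length v ≤ cs.length (cs.longest I) :=
  (cs.exists_longest I).choose_spec.2 v hv

/-- By maximality of its length, every reflection of W_I must shorten w_I. -/
theorem mem_invSet_longest {I : Set B} {t : W} :
    t ∈ cs.invSet (cs.longest I) ↔ cs.IsReflection t ∧ t ∈ cs.parabolic I := by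
  constructor
  · intro h
    exact ⟨h.1, cs.invSet_subset_parabolic (cs.longest_mem I) h⟩
  · rintro ⟨h1, h2⟩
    exact ⟨h1, lt_of_le_of_ne (cs.length_le_longest (mul_mem h2 (cs.longest_mem I)))
      (h1.length_mul_right_ne _)⟩

theorem weakLE_longest {I : Set B} {u : W} (hu : u ∈ cs.parabolic I) :
    cs.weakLE u (cs.longest I) := by
  rw [weakLE_iff_invSet_subset]
  intro t ht
  exact cs.mem_invSet_longest.2 ⟨ht.1, cs.invSet_subset_parabolic hu ht⟩

theorem longest_mul_self (I : Set B) : cs.longest I * cs.longest I = 1 := by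
  apply cs.eq_one_of_invSet_eq_empty
  rw [Set.eq_empty_iff_forall_notMem]
  intro t ht
  have hm := cs.longest_mem I
  have h1 : cs.IsReflection t := ht.1
  have h2 : t ∈ cs.parabolic I := cs.invSet_subset_parabolic (mul_mem hm hm) ht
  have h3 : cs.IsReflection ((cs.longest I)⁻¹ * t * cs.longest I) := by
    simpa using h1.conj (cs.longest I)⁻¹
  have h4 := mul_mem (mul_mem (inv_mem hm) h2) hm
  rw [mem_invSet_mul, mem_invSet_longest, mem_invSet_longest, Xor] at ht
  tauto

theorem longest_inv (I : Set B) : (cs.longest I)⁻¹ = cs.longest I :=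
  inv_eq_of_mul_eq_one_left (cs.longest_mul_self I)

theorem longest_mul_longest_mul (I : Set B) (w : W) :
    cs.longest I * (cs.longest I * w) = w := by
  rw [← mul_assoc, longest_mul_self, one_mul]

theorem mul_longest_mul_longest (I : Set B) (w : W) :
    w * cs.longest I * cs.longest I = w := by
  rw [mul_assoc, longest_mul_self, mul_one]

/-- The simple inversions of u and of w_I cancel in u w_I, which is then an element of W_I without
left descent in I, hence 1. -/
theorem eq_longest_of_leftDescents {I : Set B} {u : W} (hu : u ∈ cs.parabolic I)
    (h : ∀ i ∈ I, cs.IsLeftDescent u i) : u = cs.longest I := by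
  have hm := cs.longest_mem I
  have h1 : u * cs.longest I = 1 := by
    refine cs.eq_one_of_isLeftMin_of_mem (J := I) (cs.isLeftMin_iff.2 fun i hi hd => ?_)
      (mul_mem hu hm)
    rw [← simple_mem_invSet, mem_invSet_mul, mem_invSet_longest] at hd
    have h2 := cs.simple_mem_invSet.2 (h i hi)
    have h3 : cs.IsReflection (u⁻¹ * cs.simple i * u) := by
      simpa using (cs.isReflection_simple i).conj u⁻¹
    have h4 := mul_mem (mul_mem (inv_mem hu) (cs.simple_mem_parabolic hi)) hu
    rw [Xor] at hd
    tauto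
  rw [← cs.longest_inv, eq_inv_of_mul_eq_one_left h1]

theorem isLeftDescent_longest {I : Set B} {i : B} (hi : i ∈ I) :
    cs.IsLeftDescent (cs.longest I) i := by
  rw [← simple_mem_invSet, mem_invSet_longest]
  exact ⟨cs.isReflection_simple i, cs.simple_mem_parabolic hi⟩

/-- The projection of b to W_I has the same left descents in I as b; if these are all of I, the
projection is w_I. -/
theorem longest_weakLE_iff {I : Set B} {b : W} :
    cs.weakLE (cs.longest I) b ↔ ∀ i ∈ I, cs.IsLeftDescent b i := by
  constructor
  · intro h i hi
    exact cs.simple_weakLE_iff.1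
      (cs.weakLE_trans (cs.simple_weakLE_iff.2 (cs.isLeftDescent_longest hi)) h)
  · intro h
    obtain ⟨u, hu, v, hv, rfl⟩ := cs.exists_parabolic_mul_isLeftMin I b
    have : u = cs.longest I := cs.eq_longest_of_leftDescents hu fun i hi =>
      cs.simple_mem_invSet.1 ((cs.mem_invSet_mul_of_isLeftMin hu hv
        (cs.simple_mem_parabolic hi)).1 (cs.simple_mem_invSet.2 (h i hi)))
    rw [← this]
    exact cs.weakLE_mul_of_isLeftMin hu hv

theorem longest_weakLE_longest_iff {I J : Set B} :
    cs.weakLE (cs.longest I) (cs.longest J) ↔ I ⊆ J := by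
  rw [longest_weakLE_iff]
  constructor
  · intro h i hi
    rw [← cs.simple_mem_parabolic_iff]
    exact (cs.mem_invSet_longest.1 (cs.simple_mem_invSet.2 (h i hi))).2
  · intro h i hi
    exact cs.isLeftDescent_longest (h hi)

theorem longest_injective : Function.Injective cs.longest := by
  intro I J h
  apply Set.Subset.antisymm <;> rw [← cs.longest_weakLE_longest_iff, h] <;> exact cs.weakLE_refl _

theorem longest_empty : cs.longest ∅ = 1 := by
  have := cs.longest_mem ∅
  rwa [parabolic_empty, Subgroup.mem_bot] at this

/-- `x w_I` is the join of the elements `x s`, `s ∈ I`. -/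
theorem mul_longest_weakLE_iff {I : Set B} {x b : W} (hx : x ∈ cs.minReps I)
    (hb : cs.weakLE x b) :
    cs.weakLE (x * cs.longest I) b ↔ ∀ i ∈ I, cs.weakLE (x * cs.simple i) b := by
  obtain ⟨c, rfl⟩ : ∃ c, b = x * c := ⟨x⁻¹ * b, by group⟩
  rw [cs.weakLE_mul_mul_iff (cs.weakLE_mul_of_mem_minReps hx (cs.longest_mem I)) hb,
    longest_weakLE_iff]
  refine forall₂_congr fun i hi => ?_
  rw [cs.weakLE_mul_mul_iff (cs.weakLE_mul_of_mem_minReps hx (cs.simple_mem_parabolic hi)) hb,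
    simple_weakLE_iff]

theorem mul_longest_weakLE_mul_longest_iff {I J : Set B} {x : W} (hI : x ∈ cs.minReps I)
    (hJ : x ∈ cs.minReps J) :
    cs.weakLE (x * cs.longest I) (x * cs.longest J) ↔ I ⊆ J := by
  rw [cs.weakLE_mul_mul_iff (cs.weakLE_mul_of_mem_minReps hI (cs.longest_mem I))
    (cs.weakLE_mul_of_mem_minReps hJ (cs.longest_mem J)), longest_weakLE_longest_iff]

theorem length_longest_mul {I : Set B} {u : W} (hu : u ∈ cs.parabolic I) :
    cs.length (cs.longest I * u) + cs.length u = cs.length (cs.longest I) := by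
  have h := cs.weakLE_longest (inv_mem hu)
  unfold weakLE at h
  rw [inv_inv, length_inv] at h
  have h2 : cs.length (cs.longest I * u) = cs.length (u⁻¹ * cs.longest I) := by
    rw [← length_inv, mul_inv_rev, longest_inv]
  have h3 := cs.weakLE_longest hu
  unfold weakLE at h3
  omega

theorem longest_mul_weakLE_longest_mul_iff {I : Set B} {u v : W} (hu : u ∈ cs.parabolic I)
    (hv : v ∈ cs.parabolic I) :
    cs.weakLE (cs.longest I * u) (cs.longest I * v) ↔ cs.weakLE v u := by
  have h1 := cs.length_longest_mul hu
  have h2 := cs.length_longest_mul hv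
  have h3 : cs.length (v⁻¹ * u) = cs.length (u⁻¹ * v) := by
    rw [← length_inv, mul_inv_rev, inv_inv]
  unfold weakLE
  rw [show (cs.longest I * u)⁻¹ * (cs.longest I * v) = u⁻¹ * v by group]
  omega

/-- If the face `y W_J` has its top above `w_L`, then the projection to `W_L` of its bottom `y` is
again the bottom of a face containing `w_L`. -/
theorem exists_eq_longest_mul_longest {J L : Set B} {u v : W} (hu : u ∈ cs.parabolic L)
    (hv : cs.IsLeftMin L v) (hy : u * v ∈ cs.minReps J)
    (h : cs.weakLE (cs.longest L) (u * v * cs.longest J)) :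
    ∃ K ⊆ L, u = cs.longest L * cs.longest K := by
  rw [weakLE_iff_invSet_subset] at h
  -- Such a t inverts u v w_J, which lies above w_L, but not u v; so its conjugate by (uv)⁻¹ is an
  -- inversion of w_J.
  have key : ∀ t ∈ cs.parabolic L, cs.IsReflection t → t ∉ cs.invSet u →
      v⁻¹ * (u⁻¹ * t * u) * v ∈ cs.parabolic J := by
    intro t ht hr htu
    have h1 := h (cs.mem_invSet_longest.2 ⟨hr, ht⟩)
    rw [mem_invSet_mul, cs.mem_invSet_mul_of_isLeftMin hu hv ht] at h1
    rcases h1 with h1 | h1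
    · exact absurd h1.1 htu
    · have := (cs.mem_invSet_longest.1 h1.1).2
      simpa [mul_assoc] using this
  have hadd : ∀ a ∈ cs.parabolic L, cs.length (a * v) = cs.length a + cs.length v :=
    fun a ha => cs.weakLE_mul_iff.1 (cs.weakLE_mul_of_isLeftMin ha hv)
  -- K collects the simple reflections of W_L that stabilize the face uvW_J once u is moved aside: u
  -- s_i v lies in uvW_J for i in K. As uv is shortest there, u is shortest in uW_K.
  let K : Set B := {i | i ∈ L ∧ v⁻¹ * cs.simple i * v ∈ cs.parabolic J}
  have hKL : K ⊆ L := fun i hi => hi.1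
  have huK : u ∈ cs.minReps K := by
    rw [mem_minReps_iff]
    rintro i ⟨hi, hi'⟩ hd
    have h1 := cs.weakLE_mul_iff.1 (cs.weakLE_mul_of_mem_minReps hy hi')
    rw [show u * v * (v⁻¹ * cs.simple i * v) = u * cs.simple i * v by group,
      hadd _ (mul_mem hu (cs.simple_mem_parabolic hi)), hadd _ hu] at h1
    unfold IsRightDescent at hd
    omega
  have hle : cs.weakLE u (u * cs.longest K) :=
    cs.weakLE_mul_of_mem_minReps huK (cs.longest_mem K)
  have hKm : cs.longest K ∈ cs.parabolic L := cs.parabolic_mono hKL (cs.longest_mem K)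
  have hconj : v⁻¹ * cs.longest K * v ∈ cs.parabolic J := by
    have h1 : cs.parabolic K ≤
        (cs.parabolic J).comap (MulAut.conj v⁻¹).toMonoidHom := by
      unfold parabolic
      rw [Subgroup.closure_le]
      rintro _ ⟨i, hi, rfl⟩
      simpa [parabolic] using hi.2
    simpa using h1 (cs.longest_mem K)
  refine ⟨K, hKL, ?_⟩
  -- If s_i with i in L did not shorten g = u w_K, then g s_i g⁻¹ would not invert u, and `key`
  -- would put i into K. But s_i shortens u w_K for every i in K.
  have hfin : (u * cs.longest K)⁻¹ = cs.longest L := by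
    refine cs.eq_longest_of_leftDescents (inv_mem (mul_mem hu hKm)) fun i hi => ?_
    rw [cs.isLeftDescent_inv_iff]
    by_contra hd
    set g := u * cs.longest K with hg
    have hgm : g ∈ cs.parabolic L := mul_mem hu hKm
    have ht : g * cs.simple i * g⁻¹ ∉ cs.invSet u := by
      intro ht
      have h1 := cs.weakLE_iff_invSet_subset.1 hle ht
      have h2 : cs.length (g * cs.simple i * g⁻¹ * g) < cs.length g := h1.2
      rw [inv_mul_cancel_right] at h2
      exact hd h2
    have h3 := key _ (mul_mem (mul_mem hgm (cs.simple_mem_parabolic hi)) (inv_mem hgm))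
      ((cs.isReflection_simple i).conj g) ht
    have h4 : v⁻¹ * cs.simple i * v ∈ cs.parabolic J := by
      have := mul_mem (mul_mem (inv_mem hconj) h3) hconj
      rw [hg] at this
      convert this using 1
      group
    have h5 : i ∈ K := ⟨hi, h4⟩
    have h6 := cs.weakLE_mul_iff.1 hle
    have h7 := cs.weakLE_mul_iff.1 (cs.weakLE_mul_of_mem_minReps huK
      (mul_mem (cs.longest_mem K) (cs.simple_mem_parabolic h5)))
    have h8 := cs.length_longest_mul (cs.simple_mem_parabolic h5)
    rw [length_simple] at h8
    rw [← mul_assoc, ← hg] at h7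
    rw [← hg] at h6
    unfold IsRightDescent at hd
    omega
  rw [inv_eq_iff_eq_inv, longest_inv] at hfin
  rw [← hfin, mul_longest_mul_longest]

end

end CoxeterSystem

/-! ### Generating a lattice order from its cover relations -/

/-- Local to global, by induction on the corank of the common lower bound z. With covers x₁ ≤ x and
y₁ ≤ y of z, take p = x₁ ∨ y₁, then q = x ∨ p above x₁, then j = q ∨ y above y₁. -/
theorem exists_isJoinOf_of_cover {P : Type*} [Finite P] {c : P → P → Prop} (ρ : P → ℕ)
    (hρ : ∀ x y, c x y → ρ x < ρ y)
    (hc : ∀ z x y, c z x → c z y → ∃ j, IsJoinOf (Relation.ReflTransGen c) x y j) (z x y : P)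
    (hx : Relation.ReflTransGen c z x) (hy : Relation.ReflTransGen c z y) :
    ∃ j, IsJoinOf (Relation.ReflTransGen c) x y j := by
  obtain ⟨N, hN⟩ : ∃ N, ∀ p, ρ p ≤ N := by
    obtain ⟨N, hN⟩ := (Set.finite_range ρ).bddAbove
    exact ⟨N, fun p => hN ⟨p, rfl⟩⟩
  induction hn : N - ρ z using Nat.strong_induction_on generalizing z x y with
  | _ n ih =>
    subst hn
    rcases hx.cases_head with rfl | ⟨x₁, hx₁, hx⟩
    · exact ⟨y, hy, .refl, fun w _ h => h⟩
    rcases hy.cases_head with rfl | ⟨y₁, hy₁, hy⟩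
    · exact ⟨x, .refl, .head hx₁ hx, fun w h _ => h⟩
    have h1 : N - ρ x₁ < N - ρ z := by
      have := hρ _ _ hx₁; have := hN x₁; omega
    have h2 : N - ρ y₁ < N - ρ z := by
      have := hρ _ _ hy₁; have := hN y₁; omega
    obtain ⟨p, hp1, hp2, hp⟩ := hc z x₁ y₁ hx₁ hy₁
    obtain ⟨q, hq1, hq2, hq⟩ := ih _ h1 x₁ x p hx hp1 rfl
    obtain ⟨j, hj1, hj2, hj⟩ := ih _ h2 y₁ q y (hp2.trans hq2) hy rfl
    exact ⟨j, hq1.trans hj1, hj2, fun w hxw hyw =>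
      hj w (hq w hxw (hp w (hx.trans hxw) (hy.trans hyw))) hyw⟩

theorem isLatticeOrder_of_exists_isJoinOf {P : Type*} [Finite P] {le : P → P → Prop}
    (hrefl : ∀ x, le x x) (htrans : ∀ x y z, le x y → le y z → le x z)
    (hanti : ∀ x y, le x y → le y x → x = y) (bot : P) (hbot : ∀ x, le bot x)
    (hjoin : ∀ x y, ∃ j, IsJoinOf le x y j) : IsLatticeOrder le := by
  refine ⟨hrefl, htrans, hanti, fun x y => ?_, hjoin⟩
  have key : ∀ S : Set P, ∃ m, (∀ z ∈ S, le z m) ∧ ∀ w, (∀ z ∈ S, le z w) → le m w := by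
    intro S
    induction S, S.toFinite using Set.Finite.induction_on with
    | empty => exact ⟨bot, by simp, fun w _ => hbot w⟩
    | @insert a S _ _ ih =>
      obtain ⟨m, hm1, hm2⟩ := ih
      obtain ⟨j, hj1, hj2, hj⟩ := hjoin a m
      refine ⟨j, ?_, fun w hw => hj w (hw a (by simp)) (hm2 w fun z hz => hw z (by simp [hz]))⟩
      rintro z (rfl | hz)
      · exact hj1
      · exact htrans _ _ _ (hm1 z hz) hj2
  -- In a finite poset with joins and a least element, the meet is the join of all common lower
  -- bounds.
  obtain ⟨m, hm1, hm2⟩ := key {z | le z x ∧ le z y}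
  exact ⟨m, hm2 x fun z hz => hz.1, hm2 y fun z hz => hz.2, fun z hx hy => hm1 z ⟨hx, hy⟩⟩

namespace CoxeterSystem

section

variable {B W : Type*} [Group W] {M : CoxeterMatrix B} (cs : CoxeterSystem M W)

/-! ### The weak order is a lattice -/

/-- The cover relation of the weak order. -/
def WeakCover (u v : W) : Prop := ∃ i, ¬ cs.IsRightDescent u i ∧ v = u * cs.simple i

theorem reflTransGen_weakCover : Relation.ReflTransGen cs.WeakCover = cs.weakLE := by
  ext u v
  constructor
  · intro h
    induction h with
    | refl => exact cs.weakLE_refl u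
    | tail _ h ih =>
      obtain ⟨i, hi, rfl⟩ := h
      exact cs.weakLE_trans ih (cs.weakLE_mul_simple_iff.2 hi)
  · intro h
    induction hn : cs.length v - cs.length u using Nat.strong_induction_on generalizing u with
    | _ n ih =>
      by_cases hne : u = v
      · rw [hne]
      · obtain ⟨i, hi, hle⟩ := cs.exists_mul_simple_weakLE h hne
        have h1 := cs.weakLE_length_le hle
        have h2 := cs.not_isRightDescent_iff.1 hi
        exact .head ⟨i, hi, rfl⟩ (ih _ (by omega) _ hle rfl)

variable [Finite W]

/-- Two covers z s_i and z s_j have the join z w_{i,j}. -/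
theorem isLatticeOrder_weakLE : IsLatticeOrder cs.weakLE := by
  refine isLatticeOrder_of_exists_isJoinOf cs.weakLE_refl (fun _ _ _ => cs.weakLE_trans)
    (fun _ _ => cs.weakLE_antisymm) 1 cs.one_weakLE fun x y => ?_
  have h1 := cs.one_weakLE x
  have h2 := cs.one_weakLE y
  rw [← reflTransGen_weakCover] at h1 h2 ⊢
  refine exists_isJoinOf_of_cover cs.length ?_ ?_ 1 x y h1 h2
  · rintro u v ⟨i, hi, rfl⟩
    rw [cs.not_isRightDescent_iff.1 hi]; omega
  · rintro z _ _ ⟨i, hi, rfl⟩ ⟨j, hj, rfl⟩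
    rw [reflTransGen_weakCover]
    have hz : z ∈ cs.minReps {i, j} := by
      rw [mem_minReps_iff]
      rintro k (rfl | rfl)
      · exact hi
      · exact hj
    have hle := cs.weakLE_mul_of_mem_minReps hz (cs.longest_mem {i, j})
    have h3 := (cs.mul_longest_weakLE_iff hz hle).1 (cs.weakLE_refl _)
    refine ⟨z * cs.longest {i, j}, h3 i (by simp), h3 j (by simp), fun w hiw hjw => ?_⟩
    rw [cs.mul_longest_weakLE_iff hz (cs.weakLE_trans (cs.weakLE_mul_simple_iff.2 hi) hiw)]
    rintro k (rfl | rfl)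
    · exact hiw
    · exact hjw

end

end CoxeterSystem

namespace CoxeterSystem

section

variable {B W : Type*} [Group W] {M : CoxeterMatrix B} (cs : CoxeterSystem M W)

/-! ### Faces -/

theorem coset_mul_eq {x u : W} {I : Set B} (hu : u ∈ cs.parabolic I) :
    cs.coset (x * u) I = cs.coset x I := by
  apply Subtype.ext
  ext w
  change (x * u)⁻¹ * w ∈ cs.parabolic I ↔ x⁻¹ * w ∈ cs.parabolic I
  rw [mul_inv_rev, mul_assoc]
  exact Subgroup.mul_mem_cancel_left _ (inv_mem hu)

theorem coset_inj {x y : W} {I J : Set B} (hx : x ∈ cs.minReps I) (hy : y ∈ cs.minReps J)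
    (h : cs.coset x I = cs.coset y J) : x = y ∧ I = J := by
  have hmem : ∀ w, x⁻¹ * w ∈ cs.parabolic I ↔ y⁻¹ * w ∈ cs.parabolic J := fun w =>
    Set.ext_iff.mp (congrArg Subtype.val h) w
  have h1 : x⁻¹ * y ∈ cs.parabolic I := (hmem y).2 (by simp)
  have h2 : y⁻¹ * x ∈ cs.parabolic J := (hmem x).1 (by simp)
  have h3 := cs.weakLE_mul_of_mem_minReps hx h1
  have h4 := cs.weakLE_mul_of_mem_minReps hy h2
  rw [mul_inv_cancel_left] at h3 h4
  obtain rfl := cs.weakLE_antisymm h3 h4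
  refine ⟨rfl, cs.parabolic_injective ?_⟩
  ext w
  simpa using hmem (x * w)

variable {cs}

theorem Face.minRep_mem (F : cs.Face) : F.minRep ∈ cs.minReps F.type :=
  F.exists_rep.choose_spec.1

theorem Face.coset_minRep (F : cs.Face) : cs.coset F.minRep F.type = F :=
  F.exists_rep.choose_spec.2.symm

theorem minRep_coset {x : W} {I : Set B} (hx : x ∈ cs.minReps I) :
    (cs.coset x I).minRep = x :=
  (cs.coset_inj (Face.minRep_mem _) hx (Face.coset_minRep _)).1

theorem type_coset {x : W} {I : Set B} (hx : x ∈ cs.minReps I) : (cs.coset x I).type = I :=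
  (cs.coset_inj (Face.minRep_mem _) hx (Face.coset_minRep _)).2

instance [Finite W] : Finite cs.Face := Subtype.finite

variable [Finite W]

/-- The longest element of a face. -/
noncomputable def Face.maxRep (F : cs.Face) : W := F.minRep * cs.longest F.type

theorem maxRep_coset {x : W} {I : Set B} (hx : x ∈ cs.minReps I) :
    (cs.coset x I).maxRep = x * cs.longest I := by
  rw [Face.maxRep, minRep_coset hx, type_coset hx]

theorem Face.minRep_weakLE_maxRep (F : cs.Face) : cs.weakLE F.minRep F.maxRep :=
  cs.weakLE_mul_of_mem_minReps F.minRep_mem (cs.longest_mem _)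

theorem Face.ext_minRep_maxRep {F G : cs.Face} (h : F.minRep = G.minRep)
    (h' : F.maxRep = G.maxRep) : F = G := by
  unfold Face.maxRep at h'
  rw [h, mul_right_inj] at h'
  rw [← F.coset_minRep, ← G.coset_minRep, h, cs.longest_injective h']

variable (cs)

/-- These elements are the bottoms of the subfaces of xW_I that share its top x w_I. -/
theorem mul_longest_mul_longest_mem_minReps {x : W} {I K : Set B} (hx : x ∈ cs.minReps I)
    (hK : K ⊆ I) : x * (cs.longest I * cs.longest K) ∈ cs.minReps K := by
  have hKI := cs.parabolic_mono hK
  intro k hk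
  have hm := cs.longest_mem I
  have hk1 := cs.longest_mem K
  have hk2 := cs.simple_mem_parabolic hk
  have h1 := cs.weakLE_mul_iff.1 (cs.weakLE_mul_of_mem_minReps hx (mul_mem hm (hKI hk1)))
  have h2 := cs.weakLE_mul_iff.1 (cs.weakLE_mul_of_mem_minReps hx
    (mul_mem hm (hKI (mul_mem hk1 hk2))))
  have h3 := cs.length_longest_mul (hKI hk1)
  have h4 := cs.length_longest_mul (hKI (mul_mem hk1 hk2))
  have h5 := cs.length_longest_mul hk2
  rw [length_simple] at h5
  rw [show x * (cs.longest I * cs.longest K) * cs.simple k =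
    x * (cs.longest I * (cs.longest K * cs.simple k)) by group]
  omega

/-! ### The facial weak order in terms of shortest and longest elements. -/

/-- The order of faces by their shortest and longest elements. -/
def faceLE (F G : cs.Face) : Prop :=
  cs.weakLE F.minRep G.minRep ∧ cs.weakLE F.maxRep G.maxRep

theorem faceLE_refl (F : cs.Face) : cs.faceLE F F := ⟨cs.weakLE_refl _, cs.weakLE_refl _⟩

theorem faceLE_trans {F G H : cs.Face} (h : cs.faceLE F G) (h' : cs.faceLE G H) :
    cs.faceLE F H := ⟨cs.weakLE_trans h.1 h'.1, cs.weakLE_trans h.2 h'.2⟩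

theorem faceLE_antisymm {F G : cs.Face} (h : cs.faceLE F G) (h' : cs.faceLE G F) : F = G :=
  Face.ext_minRep_maxRep (cs.weakLE_antisymm h.1 h'.1) (cs.weakLE_antisymm h.2 h'.2)

/-- A rank function on faces. -/
noncomputable def faceRank (F : cs.Face) : ℕ := cs.length F.minRep + cs.length F.maxRep

theorem faceRank_lt {F G : cs.Face} (h : cs.faceLE F G) (hne : F ≠ G) :
    cs.faceRank F < cs.faceRank G := by
  have h1 := cs.weakLE_length_le h.1
  have h2 := cs.weakLE_length_le h.2
  by_contra hlt
  unfold faceRank at hlt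
  exact hne (Face.ext_minRep_maxRep (cs.eq_of_weakLE_of_length_le h.1 (by omega))
    (cs.eq_of_weakLE_of_length_le h.2 (by omega)))

/-- Treats both kinds of cover at once: going up, I gains s and u = 1; going down, I is the type of
F and u = w_I w_{I∖s}. -/
theorem exists_of_facialCover {F G : cs.Face} (h : cs.FacialCover F G) :
    F ≠ G ∧ ∃ I, F.type ⊆ I ∧ F.minRep ∈ cs.minReps I ∧ G.maxRep = F.minRep * cs.longest I ∧
      ∃ u ∈ cs.parabolic I, G.minRep = F.minRep * u := by
  cases h with
  | up x I s hs hx =>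
    have hxI : x ∈ cs.minReps I := fun i hi => hx i (Or.inl hi)
    constructor
    · intro h
      have := (cs.coset_inj hxI hx h).2
      exact hs (this ▸ Or.inr rfl)
    · rw [type_coset hxI, minRep_coset hxI, minRep_coset hx, maxRep_coset hx]
      exact ⟨_, Set.subset_union_left, hx, rfl, 1, one_mem _, by simp⟩
  | down x I s hs hx =>
    have hd : x * cs.longest I * cs.longest (I \ {s}) ∈ cs.minReps (I \ {s}) := by
      rw [mul_assoc]
      exact cs.mul_longest_mul_longest_mem_minReps hx Set.sdiff_subset
    constructor
    · intro h
      have := (cs.coset_inj hx hd h).2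
      rw [this] at hs
      exact hs.2 rfl
    · rw [type_coset hx, minRep_coset hx, minRep_coset hd, maxRep_coset hd]
      exact ⟨I, subset_rfl, hx, cs.mul_longest_mul_longest _ _, _, mul_mem (cs.longest_mem I)
        (cs.parabolic_mono Set.sdiff_subset (cs.longest_mem _)), mul_assoc _ _ _⟩

theorem faceLE_of_facialCover {F G : cs.Face} (h : cs.FacialCover F G) : cs.faceLE F G := by
  obtain ⟨-, I, hI, hx, hmax, u, hu, hmin⟩ := cs.exists_of_facialCover h
  unfold faceLE
  rw [hmax, hmin]
  exact ⟨cs.weakLE_mul_of_mem_minReps hx hu,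
    (cs.mul_longest_weakLE_mul_longest_iff F.minRep_mem hx).2 hI⟩

/-- The projection of the face `G` to `x W_L`, if `G` lies above `x W_L` in the order of longest
elements. -/
theorem exists_minRep_eq {x : W} {L : Set B} {G : cs.Face} (hx : x ∈ cs.minReps L)
    (hmin : cs.weakLE x G.minRep) (hmax : cs.weakLE (x * cs.longest L) G.maxRep) :
    ∃ K ⊆ L, ∃ v, cs.IsLeftMin L v ∧ G.minRep = x * (cs.longest L * cs.longest K * v) := by
  obtain ⟨a, ha⟩ : ∃ a, G.minRep = x * a := ⟨x⁻¹ * G.minRep, by group⟩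
  have hle := cs.weakLE_trans hmin G.minRep_weakLE_maxRep
  have hmem := G.minRep_mem
  unfold Face.maxRep at hmax hle
  rw [ha] at hmin hmax hle hmem
  rw [mul_assoc] at hmax hle
  rw [cs.weakLE_mul_mul_iff (cs.weakLE_mul_of_mem_minReps hx (cs.longest_mem L)) hle] at hmax
  obtain ⟨u, hu, v, hv, rfl⟩ := cs.exists_parabolic_mul_isLeftMin L a
  have hmem' : u * v ∈ cs.minReps G.type := by
    intro j hj
    have h1 := hmem j hj
    have h2 := cs.length_mul_le x (u * v * cs.simple j)
    rw [weakLE_mul_iff] at hmin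
    rw [← mul_assoc] at h2
    omega
  obtain ⟨K, hK, rfl⟩ := cs.exists_eq_longest_mul_longest hu hv hmem' hmax
  exact ⟨K, hK, v, hv, ha⟩

/-- By `exists_minRep_eq` the bottom of G projects to x w_I w_K in xW_I. The set K decides which
kind of cover leads from F towards G. -/
theorem exists_facialCover_faceLE {F G : cs.Face} (h : cs.faceLE F G) (hne : F ≠ G) :
    ∃ F', cs.FacialCover F F' ∧ cs.faceLE F' G := by
  obtain ⟨hmin, hmax⟩ := h
  have hx := F.minRep_mem
  have hle := cs.weakLE_trans hmin G.minRep_weakLE_maxRep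
  obtain ⟨K, hK, v, hv, hG⟩ := cs.exists_minRep_eq hx hmin hmax
  have hF := F.coset_minRep
  rw [show F.maxRep = F.minRep * cs.longest F.type from rfl] at hmax
  set x := F.minRep
  set I := F.type
  have hI := cs.longest_mem I
  by_cases hKI : K = I
  · rw [hKI, longest_mul_self, one_mul] at hG
    set b := v * cs.longest G.type with hb
    have hGmax : G.maxRep = x * b := by rw [Face.maxRep, hG, hb, mul_assoc]
    rw [hGmax] at hmax hle
    -- The bottom of G projects to x itself. An ascent of x towards the top of G outside I allows an
    -- upward cover.
    by_cases hD : ∃ s, cs.IsLeftDescent b s ∧ s ∉ I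
    · obtain ⟨s, hs, hsI⟩ := hD
      obtain ⟨h1, h2⟩ := cs.weakLE_mul_mul hle (cs.simple_weakLE_iff.2 hs)
      have hx' : x ∈ cs.minReps (I ∪ {s}) := by
        rw [mem_minReps_iff]
        rintro i (hi | rfl)
        · exact cs.mem_minReps_iff.1 hx i hi
        · exact cs.weakLE_mul_simple_iff.1 h1
      refine ⟨cs.coset x (I ∪ {s}), ?_, ?_⟩
      · have := FacialCover.up x I s hsI hx'
        rwa [hF] at this
      · refine ⟨by rwa [minRep_coset hx'], ?_⟩
        rw [maxRep_coset hx', hGmax, cs.mul_longest_weakLE_iff hx' hle]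
        rintro i (hi | rfl)
        · exact (cs.mul_longest_weakLE_iff hx hle).1 hmax i hi
        · exact h2
    · push Not at hD
      -- Without such an ascent F = G: left descents of v are descents of b, hence in I, but v has
      -- none there. So v = 1, and comparing descents gives equal types.
      have hlev : cs.weakLE v b := by
        have h1 := G.minRep_weakLE_maxRep
        rw [hGmax, hG] at h1
        rw [hG] at hmin
        exact (cs.weakLE_mul_mul_iff hmin hle).1 h1
      have hv1 : v = 1 := by
        by_contra hv1
        obtain ⟨s, hs⟩ := cs.exists_leftDescent_of_ne_one hv1
        have h1 := cs.simple_weakLE_iff.1 (cs.weakLE_trans (cs.simple_weakLE_iff.2 hs) hlev)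
        exact cs.isLeftMin_iff.1 hv s (hD s h1) hs
      rw [hv1, one_mul] at hb
      rw [hv1, mul_one] at hG
      refine absurd (Face.ext_minRep_maxRep hG.symm ?_) hne
      rw [hGmax]
      change x * cs.longest I = _
      have h1 : I ⊆ G.type := by
        rw [← cs.longest_weakLE_longest_iff, ← hb]
        exact (cs.weakLE_mul_mul_iff (cs.weakLE_mul_of_mem_minReps hx hI) hle).1 hmax
      have h2 : G.type ⊆ I := fun s hs => hD s (by rw [hb]; exact cs.isLeftDescent_longest hs)
      rw [hb, h1.antisymm h2]
  -- A generator s missing from K can be dropped: the downward cover keeps the top, and its new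
  -- bottom is still below that of G because K ⊆ I∖s.
  · obtain ⟨s, hs, hsK⟩ := Set.exists_of_ssubset (hK.ssubset_of_ne hKI)
    have hsub : I \ {s} ⊆ I := Set.sdiff_subset
    have hd := cs.mul_longest_mul_longest_mem_minReps hx hsub
    refine ⟨cs.coset (x * cs.longest I * cs.longest (I \ {s})) (I \ {s}), ?_, ?_⟩
    · have := FacialCover.down x I s hs hx
      rwa [hF] at this
    · rw [mul_assoc]
      refine ⟨?_, ?_⟩
      · rw [minRep_coset hd, hG]
        have hKm := cs.parabolic_mono hK (cs.longest_mem K)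
        rw [hG] at hmin
        refine (cs.weakLE_mul_mul hmin (cs.weakLE_trans ?_
          (cs.weakLE_mul_of_isLeftMin (mul_mem hI hKm) hv))).2
        rw [cs.longest_mul_weakLE_longest_mul_iff (cs.parabolic_mono hsub (cs.longest_mem _)) hKm,
          longest_weakLE_longest_iff]
        exact fun k hk => ⟨hK hk, fun h => hsK (by rw [← Set.mem_singleton_iff.1 h]; exact hk)⟩
      · rw [maxRep_coset hd, ← mul_assoc, mul_longest_mul_longest]
        exact hmax

/-- The facial weak order compares shortest elements and longest elements of faces. -/
theorem facialLE_iff {F G : cs.Face} : cs.facialLE F G ↔ cs.faceLE F G := by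
  constructor
  · intro h
    induction h with
    | refl => exact cs.faceLE_refl F
    | tail _ h ih => exact cs.faceLE_trans ih (cs.faceLE_of_facialCover h)
  · intro h
    induction hn : cs.faceRank G - cs.faceRank F using Nat.strong_induction_on generalizing F with
    | _ n ih =>
      by_cases hne : F = G
      · rw [hne]; exact .refl
      · obtain ⟨F', h1, h2⟩ := cs.exists_facialCover_faceLE h hne
        have h3 := cs.faceRank_lt (cs.faceLE_of_facialCover h1) (cs.exists_of_facialCover h1).1
        have h4 := cs.faceRank_lt h hne
        exact .head h1 (ih _ (by omega) h2 rfl)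

theorem facialLE_eq : cs.facialLE = cs.faceLE := by
  ext F G
  exact cs.facialLE_iff

/-! ### The facial weak order is a lattice. -/

theorem exists_isJoinOf_of_facialCover {F F₁ F₂ : cs.Face} (h₁ : cs.FacialCover F F₁)
    (h₂ : cs.FacialCover F F₂) : ∃ H, IsJoinOf cs.faceLE F₁ F₂ H := by
  obtain ⟨-, I₁, -, hx₁, hmax₁, u₁, hu₁, hmin₁⟩ := cs.exists_of_facialCover h₁
  obtain ⟨-, I₂, -, hx₂, hmax₂, u₂, hu₂, hmin₂⟩ := cs.exists_of_facialCover h₂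
  set x := F.minRep
  set L := I₁ ∪ I₂ with hL
  have hx : x ∈ cs.minReps L := by
    rintro i (hi | hi)
    · exact hx₁ i hi
    · exact hx₂ i hi
  replace hu₁ := cs.parabolic_mono (Set.subset_union_left (t := I₂)) hu₁
  replace hu₂ := cs.parabolic_mono (Set.subset_union_right (s := I₁)) hu₂
  have hLm := cs.longest_mem L
  have hlem : ∀ {a}, a ∈ cs.parabolic L → cs.weakLE x (x * a) :=
    fun ha => cs.weakLE_mul_of_mem_minReps hx ha
  -- The join is the face of xW_L with top x w_L whose type K is as large as possible subject to
  -- both bottoms lying below x w_L w_K.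
  let K : Set B := {k | k ∈ L ∧ cs.IsLeftDescent (cs.longest L * u₁) k ∧
    cs.IsLeftDescent (cs.longest L * u₂) k}
  have hK : K ⊆ L := fun k hk => hk.1
  have hrev : ∀ {u : W} {A : Set B}, u ∈ cs.parabolic L → A ⊆ L →
      (cs.weakLE u (cs.longest L * cs.longest A) ↔
        ∀ k ∈ A, cs.IsLeftDescent (cs.longest L * u) k) := by
    intro u A hu hA
    rw [← longest_weakLE_iff, ← cs.longest_mul_weakLE_longest_mul_iff (mul_mem hLm hu)
      (cs.parabolic_mono hA (cs.longest_mem A)), longest_mul_longest_mul]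
  have hd := cs.mul_longest_mul_longest_mem_minReps hx hK
  have hKm := mul_mem hLm (cs.parabolic_mono hK (cs.longest_mem K))
  refine ⟨cs.coset (x * (cs.longest L * cs.longest K)) K, ?_, ?_, ?_⟩
  · refine ⟨?_, ?_⟩
    · rw [hmin₁, minRep_coset hd, cs.weakLE_mul_mul_iff (hlem hu₁) (hlem hKm), hrev hu₁ hK]
      exact fun k hk => hk.2.1
    · rw [hmax₁, maxRep_coset hd, ← mul_assoc, mul_longest_mul_longest,
        cs.mul_longest_weakLE_mul_longest_iff hx₁ hx]
      exact Set.subset_union_left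
  · refine ⟨?_, ?_⟩
    · rw [hmin₂, minRep_coset hd, cs.weakLE_mul_mul_iff (hlem hu₂) (hlem hKm), hrev hu₂ hK]
      exact fun k hk => hk.2.2
    · rw [hmax₂, maxRep_coset hd, ← mul_assoc, mul_longest_mul_longest,
        cs.mul_longest_weakLE_mul_longest_iff hx₂ hx]
      exact Set.subset_union_right
  · rintro G ⟨hG1, hG2⟩ ⟨hG3, hG4⟩
    rw [hmin₁] at hG1
    rw [hmin₂] at hG3
    rw [hmax₁] at hG2
    rw [hmax₂] at hG4
    have hxG : cs.weakLE x G.minRep := cs.weakLE_trans (hlem hu₁) hG1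
    have hxG' := cs.weakLE_trans hxG G.minRep_weakLE_maxRep
    have htop : cs.weakLE (x * cs.longest L) G.maxRep := by
      rw [cs.mul_longest_weakLE_iff hx hxG']
      rintro i (hi | hi)
      · exact (cs.mul_longest_weakLE_iff hx₁ hxG').1 hG2 i hi
      · exact (cs.mul_longest_weakLE_iff hx₂ hxG').1 hG4 i hi
    refine ⟨?_, ?_⟩
    · obtain ⟨A, hA, v, hv, hGA⟩ := cs.exists_minRep_eq hx hxG htop
      rw [hGA] at hG1 hG3 hxG ⊢
      rw [minRep_coset hd]
      have hAm := mul_mem hLm (cs.parabolic_mono hA (cs.longest_mem A))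
      -- Projecting the bottom of an upper bound G to W_L gives w_L w_A, still above u₁ and u₂; this
      -- forces A ⊆ K.
      have hproj : ∀ {u}, u ∈ cs.parabolic L →
          cs.weakLE (x * u) (x * (cs.longest L * cs.longest A * v)) →
          cs.weakLE u (cs.longest L * cs.longest A) := by
        intro u hu h
        rw [cs.weakLE_mul_mul_iff (hlem hu) hxG, weakLE_iff_invSet_subset] at h
        rw [weakLE_iff_invSet_subset]
        exact fun t ht => (cs.mem_invSet_mul_of_isLeftMin hAm hv
          (cs.invSet_subset_parabolic hu ht)).1 (h ht)
      have hAK : A ⊆ K := fun k hk => ⟨hA hk, (hrev hu₁ hA).1 (hproj hu₁ hG1) k hk,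
        (hrev hu₂ hA).1 (hproj hu₂ hG3) k hk⟩
      refine (cs.weakLE_mul_mul hxG (cs.weakLE_trans ?_
        (cs.weakLE_mul_of_isLeftMin hAm hv))).2
      rw [cs.longest_mul_weakLE_longest_mul_iff (cs.parabolic_mono hK (cs.longest_mem K))
        (cs.parabolic_mono hA (cs.longest_mem A)), longest_weakLE_longest_iff]
      exact hAK
    · rw [maxRep_coset hd, ← mul_assoc, mul_longest_mul_longest]
      exact htop

theorem isLatticeOrder_facialLE : IsLatticeOrder cs.facialLE := by
  have hbot : ∀ F, cs.facialLE (cs.coset 1 ∅) F := by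
    intro F
    have h1 : (1 : W) ∈ cs.minReps ∅ := fun _ h => absurd h (Set.notMem_empty _)
    rw [facialLE_iff, faceLE, minRep_coset h1, maxRep_coset h1, longest_empty, one_mul]
    exact ⟨cs.one_weakLE _, cs.one_weakLE _⟩
  refine isLatticeOrder_of_exists_isJoinOf (fun _ => .refl) (fun _ _ _ h h' => h.trans h')
    (fun F G h h' => cs.faceLE_antisymm (cs.facialLE_iff.1 h) (cs.facialLE_iff.1 h'))
    (cs.coset 1 ∅) hbot fun F G => ?_
  refine exists_isJoinOf_of_cover cs.faceRank (fun F G h => cs.faceRank_lt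
    (cs.faceLE_of_facialCover h) (cs.exists_of_facialCover h).1) (fun F F₁ F₂ h₁ h₂ => ?_)
    (cs.coset 1 ∅) F G (hbot F) (hbot G)
  change ∃ j, IsJoinOf cs.facialLE F₁ F₂ j
  rw [facialLE_eq]
  exact cs.exists_isJoinOf_of_facialCover h₁ h₂

end

end CoxeterSystem

/-! ### Lattice congruences from pairs of projections -/

/-- The common fibers of an order preserving closure operator and an order preserving interior
operator form a lattice congruence. -/
theorem isLatticeCongruence_of_projections {P : Type*} {le : P → P → Prop}
    (htrans : ∀ x y z, le x y → le y z → le x z) (hanti : ∀ x y, le x y → le y x → x = y)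
    {up down : P → P} (hup : ∀ x, le x (up x)) (hdown : ∀ x, le (down x) x)
    (hupm : ∀ x y, le x y → le (up x) (up y)) (hdownm : ∀ x y, le x y → le (down x) (down y))
    (hupup : ∀ x, up (up x) = up x) (hdowndown : ∀ x, down (down x) = down x)
    (hfib : ∀ x y, up x = up y ↔ down x = down y) :
    IsLatticeCongruence le (fun x y => up x = up y) := by
  have hj : ∀ x x' y y' j j', up x = up x' → up y = up y' →
      IsJoinOf le x y j → IsJoinOf le x' y' j' → le (up j') (up j) := by
    -- `up j` bounds x' and y', since x' ≤ up x' = up x ≤ up j, and likewise for y'.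
    rintro x x' y y' j j' hx hy ⟨h1, h2, -⟩ ⟨-, -, h3⟩
    rw [← hupup j]
    exact hupm _ _ (h3 _ (htrans _ _ _ (hup x') (hx ▸ hupm _ _ h1))
      (htrans _ _ _ (hup y') (hy ▸ hupm _ _ h2)))
  have hm : ∀ x x' y y' m m', down x = down x' → down y = down y' →
      IsMeetOf le x y m → IsMeetOf le x' y' m' → le (down m) (down m') := by
    rintro x x' y y' m m' hx hy ⟨h1, h2, -⟩ ⟨-, -, h3⟩
    rw [← hdowndown m]
    exact hdownm _ _ (h3 _ (htrans _ _ _ (hx ▸ hdownm _ _ h1) (hdown x'))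
      (htrans _ _ _ (hy ▸ hdownm _ _ h2) (hdown y')))
  refine ⟨⟨fun _ => rfl, fun h => h.symm, fun h h' => h.trans h'⟩, ?_, ?_⟩
  · intro x x' y y' m m' hx hy h h'
    rw [hfib] at hx hy ⊢
    exact hanti _ _ (hm _ _ _ _ _ _ hx hy h h') (hm _ _ _ _ _ _ hx.symm hy.symm h' h)
  · intro x x' y y' j j' hx hy h h'
    exact hanti _ _ (hj _ _ _ _ _ _ hx.symm hy.symm h' h) (hj _ _ _ _ _ _ hx hy h h')

theorem isJoinOf_of_le {P : Type*} {le : P → P → Prop} (hrefl : ∀ x, le x x) {x y : P}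
    (h : le x y) : IsJoinOf le x y y := ⟨h, hrefl y, fun _ _ h => h⟩

theorem isMeetOf_of_le {P : Type*} {le : P → P → Prop} (hrefl : ∀ x, le x x) {x y : P}
    (h : le x y) : IsMeetOf le x y x := ⟨hrefl x, h, fun _ h _ => h⟩

namespace CoxeterSystem

section

variable {B W : Type*} [Group W] {M : CoxeterMatrix B} (cs : CoxeterSystem M W)

variable {cs} in
theorem IsClassMax.unique {r : W → W → Prop} {x m m' : W}
    (h : cs.IsClassMax r x m) (h' : cs.IsClassMax r x m') : m = m' :=
  cs.weakLE_antisymm (h'.2 _ h.1) (h.2 _ h'.1)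

variable {r : W → W → Prop}

theorem not_rel_mul_simple {X : W} {s : B} (hX : ∀ y, r X y → cs.weakLE y X)
    (hs : ¬ cs.IsRightDescent X s) : ¬ r X (X * cs.simple s) := fun h =>
  cs.mul_simple_ne X s (cs.weakLE_antisymm (hX _ h) (cs.weakLE_mul_simple_iff.2 hs))

variable [Finite W]

/-! ### Greatest and least elements of classes -/

/-- An element of maximal length in its class absorbs joins with all other members, as these joins
stay in the class. -/
theorem exists_isClassMax (hr : IsLatticeCongruence cs.weakLE r) (x : W) :
    ∃ m, cs.IsClassMax r x m := by
  obtain ⟨m, hm, hmax⟩ := Set.exists_max_image {y | r x y} cs.length (Set.toFinite _)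
    ⟨x, hr.equivalence.refl x⟩
  refine ⟨m, hm, fun y hy => ?_⟩
  obtain ⟨j, hj⟩ := cs.isLatticeOrder_weakLE.exists_join m y
  have h1 : r m j := hr.join m m m y m j (hr.equivalence.refl m)
    (hr.equivalence.trans (hr.equivalence.symm hm) hy)
    (isJoinOf_of_le cs.weakLE_refl (cs.weakLE_refl m)) hj
  have h2 := cs.eq_of_weakLE_of_length_le hj.1 (hmax j (hr.equivalence.trans hm h1))
  rw [h2]
  exact hj.2.1

theorem isClassMax_projUp (hr : IsLatticeCongruence cs.weakLE r) (x : W) :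
    cs.IsClassMax r x (cs.projUp r x) :=
  Classical.epsilon_spec (cs.exists_isClassMax hr x)

theorem weakLE_projUp (hr : IsLatticeCongruence cs.weakLE r) (x : W) :
    cs.weakLE x (cs.projUp r x) :=
  (cs.isClassMax_projUp hr x).2 x (hr.equivalence.refl x)

theorem projUp_eq_iff (hr : IsLatticeCongruence cs.weakLE r) {x y : W} :
    cs.projUp r x = cs.projUp r y ↔ r x y := by
  have hx := cs.isClassMax_projUp hr x
  have hy := cs.isClassMax_projUp hr y
  constructor
  · intro h
    exact hr.equivalence.trans (h ▸ hx.1) (hr.equivalence.symm hy.1)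
  · intro h
    exact hx.unique ⟨hr.equivalence.trans h hy.1,
      fun z hz => hy.2 z (hr.equivalence.trans (hr.equivalence.symm h) hz)⟩

theorem projUp_mono (hr : IsLatticeCongruence cs.weakLE r) {x y : W} (h : cs.weakLE x y) :
    cs.weakLE (cs.projUp r x) (cs.projUp r y) := by
  have hx := cs.isClassMax_projUp hr x
  have hy := cs.isClassMax_projUp hr y
  obtain ⟨j, hj⟩ := cs.isLatticeOrder_weakLE.exists_join (cs.projUp r x) y
  have h1 : r y j := hr.join x _ y y y j hx.1 (hr.equivalence.refl y)
    (isJoinOf_of_le cs.weakLE_refl h) hj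
  exact cs.weakLE_trans hj.1 (hy.2 j h1)

/-! ### The set `Σ↑` -/

theorem isMeetOf_mul_simple {X b : W} {s : B} (hs : ¬ cs.IsRightDescent X s)
    (hb : cs.weakLE X b) (hsb : ¬ cs.weakLE (X * cs.simple s) b) :
    IsMeetOf cs.weakLE (X * cs.simple s) b X := by
  obtain ⟨m, hm⟩ := cs.isLatticeOrder_weakLE.exists_meet (X * cs.simple s) b
  rcases cs.eq_or_eq_of_weakLE_mul_simple hs
    (hm.2.2 X (cs.weakLE_mul_simple_iff.2 hs) hb) hm.1 with rfl | rfl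
  · exact hm
  · exact absurd hm.2.1 hsb

theorem mul_simple_weakLE_mul_longest_iff {X : W} {s : B} {J : Set B}
    (hs : ¬ cs.IsRightDescent X s) (hJ : X ∈ cs.minReps J) :
    cs.weakLE (X * cs.simple s) (X * cs.longest J) ↔ s ∈ J := by
  rw [cs.weakLE_mul_mul_iff (cs.weakLE_mul_simple_iff.2 hs)
    (cs.weakLE_mul_of_mem_minReps hJ (cs.longest_mem J)), ← simple_mem_parabolic_iff cs (J := J),
    simple_weakLE_iff, ← simple_mem_invSet, mem_invSet_longest]
  exact and_iff_right (cs.isReflection_simple s)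

/-- Above the greatest element `X` of a class, the tops of the faces with bottom `X` are pairwise
incongruent. -/
theorem subset_of_rel_mul_longest (hr : IsLatticeCongruence cs.weakLE r) {X : W} {J J' : Set B}
    (hX : ∀ y, r X y → cs.weakLE y X) (hJ : X ∈ cs.minReps J) (hJ' : X ∈ cs.minReps J')
    (h : r (X * cs.longest J) (X * cs.longest J')) : J ⊆ J' := by
  intro s hs
  by_contra hs'
  have hd := cs.mem_minReps_iff.1 hJ s hs
  -- Meeting the two congruent tops with X s gives X on one side and X s on the other, contradicting
  -- that X is greatest in its class.
  have hm := cs.isMeetOf_mul_simple hd (cs.weakLE_mul_of_mem_minReps hJ' (cs.longest_mem J'))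
    (fun h => hs' ((cs.mul_simple_weakLE_mul_longest_iff hd hJ').1 h))
  have hm' := isMeetOf_of_le cs.weakLE_refl ((cs.mul_simple_weakLE_mul_longest_iff hd hJ).2 hs)
  exact cs.not_rel_mul_simple hX hd
    (hr.meet _ _ _ _ _ _ (hr.equivalence.refl _) (hr.equivalence.symm h) hm hm')

theorem eq_of_rel_mul_longest (hr : IsLatticeCongruence cs.weakLE r) {X : W} {J J' : Set B}
    (hX : ∀ y, r X y → cs.weakLE y X) (hJ : X ∈ cs.minReps J) (hJ' : X ∈ cs.minReps J')
    (h : r (X * cs.longest J) (X * cs.longest J')) : J = J' :=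
  (cs.subset_of_rel_mul_longest hr hX hJ hJ' h).antisymm
    (cs.subset_of_rel_mul_longest hr hX hJ' hJ (hr.equivalence.symm h))

theorem projUp_greatest (hr : IsLatticeCongruence cs.weakLE r) (x y : W)
    (h : r (cs.projUp r x) y) : cs.weakLE y (cs.projUp r x) :=
  (cs.isClassMax_projUp hr x).2 y (hr.equivalence.trans (cs.isClassMax_projUp hr x).1 h)

/-- If `x ⋖ x s` is not contracted, then `π↑(x) ∨ x s` covers `π↑(x)`. -/
theorem exists_mul_simple_weakLE_projUp_mul (hr : IsLatticeCongruence cs.weakLE r) {x b : W}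
    {i : B} (hi : ¬ cs.IsRightDescent x i) (hxi : ¬ r x (x * cs.simple i))
    (hb : IsJoinOf cs.weakLE (cs.projUp r x) (x * cs.simple i) b) :
    ∃ s, ¬ cs.IsRightDescent (cs.projUp r x) s ∧ b = cs.projUp r x * cs.simple s := by
  set X := cs.projUp r x with hXdef
  have hX := cs.projUp_greatest hr x
  rw [← hXdef] at hX
  have hxX := cs.weakLE_projUp hr x
  have hrX := (cs.isClassMax_projUp hr x).1
  have hle := cs.weakLE_mul_simple_iff.2 hi
  have hrb : r (x * cs.simple i) b := hr.join x X _ _ _ b hrX (hr.equivalence.refl _)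
    (isJoinOf_of_le cs.weakLE_refl hle) hb
  have hne : X ≠ b := by
    intro h
    rw [← h] at hrb
    exact hxi (hr.equivalence.trans hrX (hr.equivalence.symm hrb))
  obtain ⟨s, hs, hsb⟩ := cs.exists_mul_simple_weakLE hb.1 hne
  refine ⟨s, hs, cs.weakLE_antisymm (hb.2.2 _ (cs.weakLE_mul_simple_iff.2 hs) ?_) hsb⟩
  -- Since b ≡ x s_i, this meet is congruent to X s ∧ b = X s. It lies between x and x s_i and
  -- cannot be x, as X s is not congruent to X; hence x s_i ≤ X s.
  obtain ⟨m, hm⟩ := cs.isLatticeOrder_weakLE.exists_meet (X * cs.simple s) (x * cs.simple i)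
  have hxm := hm.2.2 x (cs.weakLE_trans hxX (cs.weakLE_mul_simple_iff.2 hs)) hle
  have hrm : r (X * cs.simple s) m := hr.meet _ _ _ _ _ _ (hr.equivalence.refl _)
    (hr.equivalence.symm hrb) (isMeetOf_of_le cs.weakLE_refl hsb) hm
  rcases cs.eq_or_eq_of_weakLE_mul_simple hi hxm hm.2.1 with rfl | rfl
  · exact absurd (hr.equivalence.symm (hr.equivalence.trans hrm hrX)) (cs.not_rel_mul_simple hX hs)
  · exact hm.1

/-- J consists of the covers of X = π↑(x) below b = X ∨ x w_I. Then X w_J ≤ b as a join of these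
covers. Conversely each x s_i is below X w_J: either it is congruent to x and below X, or X ∨ x s_i
is one of those covers. -/
theorem exists_isSigmaUp (hr : IsLatticeCongruence cs.weakLE r) {x : W} {I : Set B}
    (hx : x ∈ cs.minReps I) : ∃ J, cs.IsSigmaUp r x I J ∧
      IsJoinOf cs.weakLE (cs.projUp r x) (x * cs.longest I) (cs.projUp r x * cs.longest J) := by
  obtain ⟨b, hb⟩ := cs.isLatticeOrder_weakLE.exists_join (cs.projUp r x) (x * cs.longest I)
  set X := cs.projUp r x with hX
  have hxX := cs.weakLE_projUp hr x
  have hrX := (cs.isClassMax_projUp hr x).1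
  have hxI := cs.weakLE_mul_of_mem_minReps hx (cs.longest_mem I)
  have hrb : r (x * cs.longest I) b := hr.join x X _ _ _ b hrX (hr.equivalence.refl _)
    (isJoinOf_of_le cs.weakLE_refl hxI) hb
  let J : Set B := {s | ¬ cs.IsRightDescent X s ∧ cs.weakLE (X * cs.simple s) b}
  have hJ : X ∈ cs.minReps J := cs.mem_minReps_iff.2 fun s hs => hs.1
  have hXJ := cs.weakLE_mul_of_mem_minReps hJ (cs.longest_mem J)
  have hle : cs.weakLE (X * cs.longest J) b :=
    (cs.mul_longest_weakLE_iff hJ hb.1).2 fun s hs => hs.2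
  have hge : cs.weakLE (x * cs.longest I) (X * cs.longest J) := by
    rw [cs.mul_longest_weakLE_iff hx (cs.weakLE_trans hxX hXJ)]
    intro i hi
    by_cases hxi : r x (x * cs.simple i)
    · exact cs.weakLE_trans ((cs.isClassMax_projUp hr x).2 _ hxi) hXJ
    · obtain ⟨c, hc⟩ := cs.isLatticeOrder_weakLE.exists_join X (x * cs.simple i)
      obtain ⟨s, hs, hcs⟩ := cs.exists_mul_simple_weakLE_projUp_mul hr
        (cs.mem_minReps_iff.1 hx i hi) hxi hc
      have hcb : cs.weakLE c b := hc.2.2 b hb.1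
        ((cs.mul_longest_weakLE_iff hx (cs.weakLE_trans hxX hb.1)).1 hb.2.1 i hi)
      rw [hcs] at hcb
      have hsJ : s ∈ J := ⟨hs, hcb⟩
      refine cs.weakLE_trans hc.2.1 ?_
      rw [hcs, cs.mul_simple_weakLE_mul_longest_iff hs hJ]
      exact hsJ
  have heq : X * cs.longest J = b := cs.weakLE_antisymm hle (hb.2.2 _ hXJ hge)
  rw [← heq] at hb hrb
  exact ⟨J, ⟨fun s hs => hs.1, hge, hrb⟩, hb⟩

theorem isSigmaUp_sigmaUp (hr : IsLatticeCongruence cs.weakLE r) {x : W} {I : Set B}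
    (hx : x ∈ cs.minReps I) : cs.IsSigmaUp r x I (cs.sigmaUp r x I) := by
  obtain ⟨J, hJ, -⟩ := cs.exists_isSigmaUp hr hx
  exact Classical.epsilon_spec (⟨J, hJ⟩ : ∃ J, cs.IsSigmaUp r x I J)

theorem isSigmaUp_unique (hr : IsLatticeCongruence cs.weakLE r) {x : W} {I J J' : Set B}
    (hJ : cs.IsSigmaUp r x I J) (hJ' : cs.IsSigmaUp r x I J') : J = J' :=
  cs.eq_of_rel_mul_longest hr (cs.projUp_greatest hr x) (cs.mem_minReps_iff.2 hJ.1)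
    (cs.mem_minReps_iff.2 hJ'.1) (hr.equivalence.trans (hr.equivalence.symm hJ.2.2) hJ'.2.2)

theorem isJoinOf_sigmaUp (hr : IsLatticeCongruence cs.weakLE r) {x : W} {I : Set B}
    (hx : x ∈ cs.minReps I) : IsJoinOf cs.weakLE (cs.projUp r x) (x * cs.longest I)
      (cs.projUp r x * cs.longest (cs.sigmaUp r x I)) := by
  obtain ⟨J, hJ, hj⟩ := cs.exists_isSigmaUp hr hx
  rwa [cs.isSigmaUp_unique hr (cs.isSigmaUp_sigmaUp hr hx) hJ]

theorem projUp_mem_minReps_sigmaUp (hr : IsLatticeCongruence cs.weakLE r) {x : W} {I : Set B}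
    (hx : x ∈ cs.minReps I) : cs.projUp r x ∈ cs.minReps (cs.sigmaUp r x I) :=
  cs.mem_minReps_iff.2 (cs.isSigmaUp_sigmaUp hr hx).1

/-! ### The map Π↑ on faces. -/

theorem facialUp_coset {x : W} {I : Set B} (hx : x ∈ cs.minReps I) :
    cs.facialUp r (cs.coset x I) = cs.coset (cs.projUp r x) (cs.sigmaUp r x I) := by
  rw [facialUp, minRep_coset hx, type_coset hx]

theorem minRep_facialUp (hr : IsLatticeCongruence cs.weakLE r) (F : cs.Face) :
    (cs.facialUp r F).minRep = cs.projUp r F.minRep :=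
  minRep_coset (cs.projUp_mem_minReps_sigmaUp hr F.minRep_mem)

theorem maxRep_facialUp (hr : IsLatticeCongruence cs.weakLE r) (F : cs.Face) :
    (cs.facialUp r F).maxRep =
      cs.projUp r F.minRep * cs.longest (cs.sigmaUp r F.minRep F.type) :=
  maxRep_coset (cs.projUp_mem_minReps_sigmaUp hr F.minRep_mem)

theorem isJoinOf_maxRep_facialUp (hr : IsLatticeCongruence cs.weakLE r) (F : cs.Face) :
    IsJoinOf cs.weakLE (cs.projUp r F.minRep) F.maxRep (cs.facialUp r F).maxRep := by
  rw [cs.maxRep_facialUp hr]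
  exact cs.isJoinOf_sigmaUp hr F.minRep_mem

theorem rel_minRep_facialUp (hr : IsLatticeCongruence cs.weakLE r) (F : cs.Face) :
    r F.minRep (cs.facialUp r F).minRep := by
  rw [cs.minRep_facialUp hr]
  exact (cs.isClassMax_projUp hr _).1

theorem rel_maxRep_facialUp (hr : IsLatticeCongruence cs.weakLE r) (F : cs.Face) :
    r F.maxRep (cs.facialUp r F).maxRep := by
  rw [cs.maxRep_facialUp hr]
  exact (cs.isSigmaUp_sigmaUp hr F.minRep_mem).2.2

/-- Congruent bottoms give the same X = π↑(min), and the tops over X are pairwise incongruent. The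
criterion is symmetric in the two endpoints, so duality yields the same fibers for Π↓. -/
theorem facialUp_eq_iff (hr : IsLatticeCongruence cs.weakLE r) {F G : cs.Face} :
    cs.facialUp r F = cs.facialUp r G ↔ r F.minRep G.minRep ∧ r F.maxRep G.maxRep := by
  have hF := cs.rel_maxRep_facialUp hr F
  have hG := cs.rel_maxRep_facialUp hr G
  constructor
  · intro h
    rw [← h] at hG
    refine ⟨?_, hr.equivalence.trans hF (hr.equivalence.symm hG)⟩
    rw [← cs.projUp_eq_iff hr, ← cs.minRep_facialUp hr, h, cs.minRep_facialUp hr]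
  · rintro ⟨h1, h2⟩
    rw [← cs.projUp_eq_iff hr] at h1
    have hrel := hr.equivalence.trans (hr.equivalence.symm hF) (hr.equivalence.trans h2 hG)
    rw [cs.maxRep_facialUp hr, cs.maxRep_facialUp hr, ← h1] at hrel
    have hG' := cs.projUp_mem_minReps_sigmaUp hr G.minRep_mem
    rw [← h1] at hG'
    rw [facialUp, facialUp, ← h1, cs.eq_of_rel_mul_longest hr (cs.projUp_greatest hr _)
      (cs.projUp_mem_minReps_sigmaUp hr F.minRep_mem) hG' hrel]

theorem facialLE_facialUp (hr : IsLatticeCongruence cs.weakLE r) (F : cs.Face) :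
    cs.facialLE F (cs.facialUp r F) := by
  rw [facialLE_iff, faceLE, cs.minRep_facialUp hr]
  exact ⟨cs.weakLE_projUp hr _, (cs.isJoinOf_maxRep_facialUp hr F).2.1⟩

/-- Both endpoints of Π↑(F) are monotone in those of F: the top is the join of π↑(min) and max. -/
theorem facialUp_mono (hr : IsLatticeCongruence cs.weakLE r) {F G : cs.Face}
    (h : cs.facialLE F G) : cs.facialLE (cs.facialUp r F) (cs.facialUp r G) := by
  rw [facialLE_iff] at h ⊢
  have h1 := cs.projUp_mono hr h.1
  have hG := cs.isJoinOf_maxRep_facialUp hr G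
  rw [faceLE, cs.minRep_facialUp hr, cs.minRep_facialUp hr]
  exact ⟨h1, (cs.isJoinOf_maxRep_facialUp hr F).2.2 _ (cs.weakLE_trans h1 hG.1)
    (cs.weakLE_trans h.2 hG.2.1)⟩

end

end CoxeterSystem

namespace CoxeterSystem

section

variable {B W : Type*} [Group W] {M : CoxeterMatrix B} (cs : CoxeterSystem M W)

variable {cs} in
theorem IsClassMin.unique {r : W → W → Prop} {x m m' : W}
    (h : cs.IsClassMin r x m) (h' : cs.IsClassMin r x m') : m = m' :=
  cs.weakLE_antisymm (h.2 _ h'.1) (h'.2 _ h.1)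

theorem mem_parabolic_univ (w : W) : w ∈ cs.parabolic Set.univ := by
  rw [parabolic_univ]; trivial

variable [Finite W] {r : W → W → Prop}

/-! ### Duality by the longest element -/

/-- The complement `w₀ w` of `w`. -/
noncomputable def compl (w : W) : W := cs.longest Set.univ * w

theorem compl_compl (w : W) : cs.compl (cs.compl w) = w := cs.longest_mul_longest_mul _ w

theorem compl_mul (u v : W) : cs.compl (u * v) = cs.compl u * v := (mul_assoc _ _ _).symm

theorem compl_weakLE_compl_iff {u v : W} :
    cs.weakLE (cs.compl u) (cs.compl v) ↔ cs.weakLE v u :=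
  cs.longest_mul_weakLE_longest_mul_iff (cs.mem_parabolic_univ u) (cs.mem_parabolic_univ v)

theorem compl_weakLE_iff {u v : W} : cs.weakLE (cs.compl u) v ↔ cs.weakLE (cs.compl v) u := by
  rw [← compl_weakLE_compl_iff, compl_compl]

theorem weakLE_compl_iff {u v : W} : cs.weakLE u (cs.compl v) ↔ cs.weakLE v (cs.compl u) := by
  rw [← compl_weakLE_compl_iff, compl_compl]

theorem isRightDescent_compl_iff {w : W} {i : B} :
    cs.IsRightDescent (cs.compl w) i ↔ ¬ cs.IsRightDescent w i := by
  have h1 := cs.length_longest_mul (cs.mem_parabolic_univ w)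
  have h2 := cs.length_longest_mul (cs.mem_parabolic_univ (w * cs.simple i))
  have h3 := cs.length_mul_simple_ne w i
  rw [IsRightDescent, IsRightDescent, ← compl_mul]
  unfold compl
  omega

theorem isMeetOf_compl_iff {x y m : W} :
    IsMeetOf cs.weakLE (cs.compl x) (cs.compl y) (cs.compl m) ↔ IsJoinOf cs.weakLE x y m := by
  unfold IsMeetOf IsJoinOf
  rw [compl_weakLE_compl_iff, compl_weakLE_compl_iff]
  refine and_congr_right fun _ => and_congr_right fun _ => ⟨fun h z hx hy => ?_,
    fun h z hx hy => ?_⟩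
  · rw [← compl_weakLE_compl_iff]
    exact h _ (cs.compl_weakLE_compl_iff.2 hx) (cs.compl_weakLE_compl_iff.2 hy)
  · rw [weakLE_compl_iff] at hx hy ⊢
    exact h _ hx hy

theorem isJoinOf_compl_iff {x y m : W} :
    IsJoinOf cs.weakLE (cs.compl x) (cs.compl y) (cs.compl m) ↔ IsMeetOf cs.weakLE x y m := by
  rw [← isMeetOf_compl_iff]
  simp only [compl_compl]

/-- The image of a relation under the duality of the weak order. -/
def dualRel (r : W → W → Prop) (u v : W) : Prop := r (cs.compl u) (cs.compl v)

theorem isLatticeCongruence_dualRel (hr : IsLatticeCongruence cs.weakLE r) :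
    IsLatticeCongruence cs.weakLE (cs.dualRel r) where
  equivalence := ⟨fun _ => hr.equivalence.refl _, fun h => hr.equivalence.symm h,
    fun h h' => hr.equivalence.trans h h'⟩
  meet _ _ _ _ _ _ hx hy h h' := hr.join _ _ _ _ _ _ hx hy
    (cs.isJoinOf_compl_iff.2 h) (cs.isJoinOf_compl_iff.2 h')
  join _ _ _ _ _ _ hx hy h h' := hr.meet _ _ _ _ _ _ hx hy
    (cs.isMeetOf_compl_iff.2 h) (cs.isMeetOf_compl_iff.2 h')

theorem isClassMin_compl {x m : W} (h : cs.IsClassMax (cs.dualRel r) (cs.compl x) m) :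
    cs.IsClassMin r x (cs.compl m) := by
  have h1 := h.1
  rw [dualRel, compl_compl] at h1
  refine ⟨h1, fun y hy => ?_⟩
  rw [compl_weakLE_iff]
  exact h.2 _ (by rwa [dualRel, compl_compl, compl_compl])

theorem isClassMin_projDown (hr : IsLatticeCongruence cs.weakLE r) (x : W) :
    cs.IsClassMin r x (cs.projDown r x) :=
  Classical.epsilon_spec
    ⟨_, cs.isClassMin_compl (cs.isClassMax_projUp (cs.isLatticeCongruence_dualRel hr) (cs.compl x))⟩

theorem projUp_dualRel_compl (hr : IsLatticeCongruence cs.weakLE r) (x : W) :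
    cs.projUp (cs.dualRel r) (cs.compl x) = cs.compl (cs.projDown r x) := by
  rw [(cs.isClassMin_projDown hr x).unique (cs.isClassMin_compl
    (cs.isClassMax_projUp (cs.isLatticeCongruence_dualRel hr) (cs.compl x))), compl_compl]

theorem compl_mul_longest_mem_minReps {x : W} {I : Set B} (hx : x ∈ cs.minReps I) :
    cs.compl x * cs.longest I ∈ cs.minReps I := by
  rw [mem_minReps_iff]
  intro i hi
  rw [← compl_mul, isRightDescent_compl_iff, not_not]
  have h1 := cs.weakLE_mul_iff.1 (cs.weakLE_mul_of_mem_minReps hx (cs.longest_mem I))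
  have h2 := cs.weakLE_mul_iff.1 (cs.weakLE_mul_of_mem_minReps hx
    (mul_mem (cs.longest_mem I) (cs.simple_mem_parabolic hi)))
  have h3 := cs.length_longest_mul (cs.simple_mem_parabolic hi)
  rw [length_simple] at h3
  rw [IsRightDescent, mul_assoc]
  omega

/-- Multiplication by w₀ exchanges the endpoints: w₀ x w_I is the bottom of the dual face, and its
top is w₀ x. -/
theorem isSigmaDown_iff_isSigmaUp (hr : IsLatticeCongruence cs.weakLE r) {x : W} {I J : Set B} :
    cs.IsSigmaDown r x I J ↔
      cs.IsSigmaUp (cs.dualRel r) (cs.compl (x * cs.longest I)) I J := by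
  unfold IsSigmaDown IsSigmaUp leEquiv
  rw [cs.projUp_dualRel_compl hr, ← compl_mul, ← compl_mul, compl_weakLE_compl_iff, dualRel,
    compl_compl, compl_compl, mul_longest_mul_longest]
  simp only [isRightDescent_compl_iff, not_not]
  refine and_congr_right fun _ => and_congr_right fun _ => ⟨hr.equivalence.symm,
    hr.equivalence.symm⟩

theorem isSigmaDown_sigmaDown (hr : IsLatticeCongruence cs.weakLE r) {x : W} {I : Set B}
    (hx : x ∈ cs.minReps I) : cs.IsSigmaDown r x I (cs.sigmaDown r x I) := by
  have hx' := cs.compl_mul_longest_mem_minReps hx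
  rw [← compl_mul] at hx'
  have h := (cs.isSigmaDown_iff_isSigmaUp hr).2
    (cs.isSigmaUp_sigmaUp (cs.isLatticeCongruence_dualRel hr) hx')
  exact Classical.epsilon_spec (⟨_, h⟩ : ∃ J, cs.IsSigmaDown r x I J)

theorem isSigmaDown_unique (hr : IsLatticeCongruence cs.weakLE r) {x : W} {I J J' : Set B}
    (hJ : cs.IsSigmaDown r x I J) (hJ' : cs.IsSigmaDown r x I J') : J = J' :=
  cs.isSigmaUp_unique (cs.isLatticeCongruence_dualRel hr)
    ((cs.isSigmaDown_iff_isSigmaUp hr).1 hJ) ((cs.isSigmaDown_iff_isSigmaUp hr).1 hJ')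

/-! ### Duality of faces and the map Π↓. -/

variable {cs}

/-- The image of a face under the duality of the facial weak order. -/
noncomputable def Face.compl (F : cs.Face) : cs.Face := cs.coset (cs.compl F.maxRep) F.type

theorem Face.compl_maxRep_mem (F : cs.Face) : cs.compl F.maxRep ∈ cs.minReps F.type := by
  rw [Face.maxRep, compl_mul]
  exact cs.compl_mul_longest_mem_minReps F.minRep_mem

theorem Face.minRep_compl (F : cs.Face) : F.compl.minRep = cs.compl F.maxRep :=
  minRep_coset F.compl_maxRep_mem

theorem Face.type_compl (F : cs.Face) : F.compl.type = F.type :=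
  type_coset F.compl_maxRep_mem

theorem Face.maxRep_compl (F : cs.Face) : F.compl.maxRep = cs.compl F.minRep := by
  rw [Face.compl, maxRep_coset F.compl_maxRep_mem, ← compl_mul, Face.maxRep,
    mul_longest_mul_longest]

theorem Face.compl_compl (F : cs.Face) : F.compl.compl = F := by
  apply Face.ext_minRep_maxRep
  · rw [minRep_compl, maxRep_compl, CoxeterSystem.compl_compl]
  · rw [maxRep_compl, minRep_compl, CoxeterSystem.compl_compl]

variable (cs)

theorem facialLE_compl_iff {F G : cs.Face} :
    cs.facialLE F.compl G.compl ↔ cs.facialLE G F := by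
  rw [facialLE_iff, facialLE_iff, faceLE, faceLE, Face.minRep_compl, Face.minRep_compl,
    Face.maxRep_compl, Face.maxRep_compl, compl_weakLE_compl_iff, compl_weakLE_compl_iff, and_comm]

/-- Needed because Π↓(F) is written through its longest element π↓(x w_I), not its shortest one. -/
theorem coset_eq_compl {Y : W} {J : Set B} (h : cs.compl Y ∈ cs.minReps J) :
    cs.coset Y J = (cs.coset (cs.compl Y) J).compl := by
  rw [Face.compl, maxRep_coset h, type_coset h, ← compl_mul, compl_compl,
    cs.coset_mul_eq (cs.longest_mem J)]

theorem facialDown_eq_compl (hr : IsLatticeCongruence cs.weakLE r) (F : cs.Face) :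
    cs.facialDown r F = (cs.facialUp (cs.dualRel r) F.compl).compl := by
  have hd := cs.isLatticeCongruence_dualRel hr
  have hσ : cs.sigmaDown r F.minRep F.type =
      cs.sigmaUp (cs.dualRel r) (cs.compl F.maxRep) F.type :=
    cs.isSigmaUp_unique hd ((cs.isSigmaDown_iff_isSigmaUp hr).1
      (cs.isSigmaDown_sigmaDown hr F.minRep_mem)) (cs.isSigmaUp_sigmaUp hd F.compl_maxRep_mem)
  have hm := cs.projUp_mem_minReps_sigmaUp hd F.compl_maxRep_mem
  rw [cs.projUp_dualRel_compl hr] at hm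
  rw [facialUp, Face.minRep_compl, Face.type_compl, cs.projUp_dualRel_compl hr,
    ← cs.coset_eq_compl hm, facialDown, hσ, Face.maxRep]

theorem facialDown_coset {x : W} {I : Set B} (hx : x ∈ cs.minReps I) :
    cs.facialDown r (cs.coset x I) =
      cs.coset (cs.projDown r (x * cs.longest I)) (cs.sigmaDown r x I) := by
  rw [facialDown, minRep_coset hx, type_coset hx]

theorem facialLE_facialDown (hr : IsLatticeCongruence cs.weakLE r) (F : cs.Face) :
    cs.facialLE (cs.facialDown r F) F := by
  rw [← facialLE_compl_iff, cs.facialDown_eq_compl hr, Face.compl_compl]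
  exact cs.facialLE_facialUp (cs.isLatticeCongruence_dualRel hr) _

theorem facialDown_mono (hr : IsLatticeCongruence cs.weakLE r) {F G : cs.Face}
    (h : cs.facialLE F G) : cs.facialLE (cs.facialDown r F) (cs.facialDown r G) := by
  rw [cs.facialDown_eq_compl hr, cs.facialDown_eq_compl hr, facialLE_compl_iff]
  exact cs.facialUp_mono (cs.isLatticeCongruence_dualRel hr) ((cs.facialLE_compl_iff).2 h)

theorem facialDown_eq_iff (hr : IsLatticeCongruence cs.weakLE r) {F G : cs.Face} :
    cs.facialDown r F = cs.facialDown r G ↔ r F.minRep G.minRep ∧ r F.maxRep G.maxRep := by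
  have hinj : Function.Injective (Face.compl : cs.Face → cs.Face) :=
    Function.Involutive.injective Face.compl_compl
  rw [cs.facialDown_eq_compl hr, cs.facialDown_eq_compl hr, hinj.eq_iff,
    cs.facialUp_eq_iff (cs.isLatticeCongruence_dualRel hr)]
  simp only [Face.minRep_compl, Face.maxRep_compl, dualRel, compl_compl]
  exact and_comm

theorem rel_facialDown (hr : IsLatticeCongruence cs.weakLE r) (F : cs.Face) :
    r F.minRep (cs.facialDown r F).minRep ∧ r F.maxRep (cs.facialDown r F).maxRep := by
  have hd := cs.isLatticeCongruence_dualRel hr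
  have h1 := cs.rel_minRep_facialUp hd F.compl
  have h2 := cs.rel_maxRep_facialUp hd F.compl
  rw [Face.minRep_compl, dualRel, compl_compl] at h1
  rw [Face.maxRep_compl, dualRel, compl_compl] at h2
  rw [cs.facialDown_eq_compl hr, Face.minRep_compl, Face.maxRep_compl]
  exact ⟨h2, h1⟩

theorem facialUp_eq_facialUp_iff (hr : IsLatticeCongruence cs.weakLE r) {F G : cs.Face} :
    cs.facialUp r F = cs.facialUp r G ↔ cs.facialDown r F = cs.facialDown r G := by
  rw [cs.facialUp_eq_iff hr, cs.facialDown_eq_iff hr]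

theorem facialUp_facialUp (hr : IsLatticeCongruence cs.weakLE r) (F : cs.Face) :
    cs.facialUp r (cs.facialUp r F) = cs.facialUp r F :=
  (cs.facialUp_eq_iff hr).2 ⟨hr.equivalence.symm (cs.rel_minRep_facialUp hr F),
    hr.equivalence.symm (cs.rel_maxRep_facialUp hr F)⟩

theorem facialUp_facialDown (hr : IsLatticeCongruence cs.weakLE r) (F : cs.Face) :
    cs.facialUp r (cs.facialDown r F) = cs.facialUp r F :=
  (cs.facialUp_eq_iff hr).2 ⟨hr.equivalence.symm (cs.rel_facialDown hr F).1,
    hr.equivalence.symm (cs.rel_facialDown hr F).2⟩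

/-- The face xW_∅ has x as both endpoints, so the two conditions of `facialUp_eq_iff` coincide. -/
theorem rel_iff_facialUp_coset_empty (hr : IsLatticeCongruence cs.weakLE r) (x y : W) :
    r x y ↔ cs.facialUp r (cs.coset x ∅) = cs.facialUp r (cs.coset y ∅) := by
  have h : ∀ z : W, z ∈ cs.minReps ∅ := fun _ _ h => absurd h (Set.notMem_empty _)
  rw [cs.facialUp_eq_iff hr, minRep_coset (h x), minRep_coset (h y), maxRep_coset (h x),
    maxRep_coset (h y), longest_empty, mul_one, mul_one, and_self]

end

end CoxeterSystem

theorem theorem4p8 {B W : Type*} [Group W] [Finite W] {M : CoxeterMatrix B}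
    (cs : CoxeterSystem M W) (r : W → W → Prop) (hr : IsLatticeCongruence cs.weakLE r) :
    -- the projections of the congruence, the sets `Σ↑`, `Σ↓` and the two maps are well defined
    (∀ x, cs.IsClassMax r x (cs.projUp r x) ∧ cs.IsClassMin r x (cs.projDown r x)) ∧
    (∀ (I : Set B), ∀ x ∈ cs.minReps I,
      (cs.IsSigmaUp r x I (cs.sigmaUp r x I) ∧
        ∀ J, cs.IsSigmaUp r x I J → J = cs.sigmaUp r x I) ∧
      (cs.IsSigmaDown r x I (cs.sigmaDown r x I) ∧
        ∀ J, cs.IsSigmaDown r x I J → J = cs.sigmaDown r x I)) ∧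
    (∀ (I : Set B), ∀ x ∈ cs.minReps I,
      cs.facialUp r (cs.coset x I) = cs.coset (cs.projUp r x) (cs.sigmaUp r x I) ∧
      cs.facialDown r (cs.coset x I) =
        cs.coset (cs.projDown r (x * cs.longest I)) (cs.sigmaDown r x I)) ∧
    -- (i) sandwich
    (∀ F : cs.Face, cs.facialLE (cs.facialDown r F) F ∧ cs.facialLE F (cs.facialUp r F)) ∧
    -- (ii) compositions
    (∀ F : cs.Face,
      cs.facialUp r (cs.facialUp r F) = cs.facialUp r F ∧
      cs.facialUp r (cs.facialDown r F) = cs.facialUp r F ∧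
      cs.facialDown r (cs.facialDown r F) = cs.facialDown r F ∧
      cs.facialDown r (cs.facialUp r F) = cs.facialDown r F) ∧
    -- (iii) order preserving
    (∀ F G : cs.Face, cs.facialLE F G →
      cs.facialLE (cs.facialUp r F) (cs.facialUp r G) ∧
      cs.facialLE (cs.facialDown r F) (cs.facialDown r G)) ∧
    -- the fibers coincide and define a lattice congruence of the facial weak order, extending `r`
    (∀ F G : cs.Face,
      cs.facialUp r F = cs.facialUp r G ↔ cs.facialDown r F = cs.facialDown r G) ∧
    IsLatticeOrder cs.facialLE ∧
    IsLatticeCongruence cs.facialLE (fun F G => cs.facialUp r F = cs.facialUp r G) ∧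
    (∀ x y : W, r x y ↔ cs.facialUp r (cs.coset x ∅) = cs.facialUp r (cs.coset y ∅)) := by
  have hfib : ∀ F G : cs.Face,
      cs.facialUp r F = cs.facialUp r G ↔ cs.facialDown r F = cs.facialDown r G :=
    fun _ _ => cs.facialUp_eq_facialUp_iff hr
  have hlat := cs.isLatticeOrder_facialLE
  have hdd : ∀ F, cs.facialDown r (cs.facialDown r F) = cs.facialDown r F :=
    fun F => (hfib _ _).1 (cs.facialUp_facialDown hr F)
  refine ⟨fun x => ⟨cs.isClassMax_projUp hr x, cs.isClassMin_projDown hr x⟩,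
    fun I x hx => ⟨⟨cs.isSigmaUp_sigmaUp hr hx, fun J hJ =>
      cs.isSigmaUp_unique hr hJ (cs.isSigmaUp_sigmaUp hr hx)⟩,
      ⟨cs.isSigmaDown_sigmaDown hr hx, fun J hJ =>
      cs.isSigmaDown_unique hr hJ (cs.isSigmaDown_sigmaDown hr hx)⟩⟩,
    fun I x hx => ⟨cs.facialUp_coset hx, cs.facialDown_coset hx⟩,
    fun F => ⟨cs.facialLE_facialDown hr F, cs.facialLE_facialUp hr F⟩,
    fun F => ⟨cs.facialUp_facialUp hr F, cs.facialUp_facialDown hr F, hdd F,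
      (hfib _ _).1 (cs.facialUp_facialUp hr F)⟩,
    fun F G h => ⟨cs.facialUp_mono hr h, cs.facialDown_mono hr h⟩, hfib, hlat,
    isLatticeCongruence_of_projections hlat.trans hlat.antisymm (cs.facialLE_facialUp hr)
      (cs.facialLE_facialDown hr) (fun _ _ => cs.facialUp_mono hr)
      (fun _ _ => cs.facialDown_mono hr) (cs.facialUp_facialUp hr) hdd hfib,
    cs.rel_iff_facialUp_coset_empty hr⟩
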